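/- An \emph{$n$-space group} is a discrete subgroup $\Gamma$ of the isometry group $\mathrm{Isom}(E^n)$ of Euclidean $n$-space whose orbit space $E^n/\Gamma$ is compact. Write $a+A$ for the isometry $x\mapsto a+Ax$ with $a\in E^n$, $A\in\mathrm{O}(n)$. For a subgroup $\mathrm{H}$ of $\mathrm{Isom}(E^n)$ let $\mathrm{Span}(\mathrm{H})$ be the vector subspace of $E^n$ spanned by $\{a : a+I\in \mathrm{H}\}$. A normal subgroup $\mathrm{N}$ of $\Gamma$ with $V=\mathrm{Span}(\mathrm{N})$ is a \emph{complete normal subgroup} of $\Gamma$ if $\mathrm{N}=\{a+A\in\Gamma : a\in V \text{ and } V^\perp\subseteq\mathrm{Fix}(A)\}$. For a discrete group $\mathrm{M}\le\mathrm{Isom}(E^m)$, $\mathrm{Isom}(E^m/\mathrm{M})$ is the group of isometries of the orbit space $E^m/\mathrm{M}$ with the metric $d(\mathrm{M}x,\mathrm{M}y)=\inf_{g\in \mathrm{M}}|x-gy|$. \textbf{Theorem 18.} Let $0\le m\le n$, let $\mathrm{M}$ be an $m$-space group, let $\Delta$ be an $(n-m)$-space group, and let $\Theta:\Delta\to\mathrm{Isom}(E^m/\mathrm{M})$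 be a homomorphism. Identify $E^n$ with the orthogonal product $E^m\times E^{n-m}$, and let $\mathrm{N}\le\mathrm{Isom}(E^n)$ be the group of the isometries $(v,w)\mapsto(\nu v,w)$ with $\nu\in\mathrm{M}$. Then $\mathrm{Span}(\mathrm{N})=E^m\times\{0\}$, and there exists a unique $n$-space group $\Gamma$ with the following properties: (1) $\mathrm{N}$ is a complete normal subgroup of $\Gamma$; consequently each $\gamma\in\Gamma$ has the form $\gamma(v,w)=(\overline\gamma v,\gamma' w)$ with $\overline\gamma\in\mathrm{Isom}(E^m)$ and $\gamma'\in\mathrm{Isom}(E^{n-m})$; (2) the group $\Gamma'=\{\gamma':\gamma\in\Gamma\}$ is equal to $\Delta$; (3) $\Xi=\Theta\circ\mathrm{P}$, where $\Xi:\Gamma/\mathrm{N}\to\mathrm{Isom}(E^m/\mathrm{N})=\mathrm{Isom}(E^m/\mathrm{M})$ is the homomorphism induced by the action of $\Gamma/\mathrm{N}$ on $E^m/\mathrm{N}$, that is, $\Xi(\mathrm{N}\gamma)(\mathrm{N}v)=\mathrm{N}\,\overline\gamma(v)$, and $\mathrm{P}:\Gamma/\mathrm{N}\to\Gamma'$ is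 the isomorphism defined by $\mathrm{P}(\mathrm{N}\gamma)=\gamma'$. -/

import Mathlib

open scoped Topology

noncomputable section

/-! ### Isometries of a Euclidean space -/

/-- Euclidean `n`-space. -/
abbrev Euc (n : ℕ) : Type := EuclideanSpace ℝ (Fin n)

/-- The group `Isom(E)` of isometries `a + A`, `x ↦ a + A x`, of a Euclidean vector space `E`. -/
abbrev Isom (E : Type*) [NormedAddCommGroup E] [InnerProductSpace ℝ E] : Type _ := E ≃ᵃⁱ[ℝ] E

section General

variable {E : Type*} [NormedAddCommGroup E] [InnerProductSpace ℝ E]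

/-- `Isom(E)` carries the topology induced from the compact-open topology on `C(E, E)`. -/
instance Isom.instTopologicalSpace : TopologicalSpace (Isom E) :=
  TopologicalSpace.induced (fun g => (⟨g, g.continuous⟩ : C(E, E))) inferInstance

/-- `Isom(E)` acts on `E` by evaluation. -/
instance Isom.instMulAction : MulAction (Isom E) E where
  smul g x := g x
  one_smul _ := rfl
  mul_smul _ _ _ := rfl

theorem Isom.smul_def (g : Isom E) (x : E) : g • x = g x := rfl

theorem Isom.subgroup_smul_def {Γ : Subgroup (Isom E)} (g : Γ) (x : E) :
    g • x = (g : Isom E) x := rfl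

theorem Isom.apply_eq (g : Isom E) (x : E) : g x = g.linearIsometryEquiv x + g 0 := by
  simpa using g.map_vadd 0 x

theorem Isom.linear_eq (g : Isom E) (x : E) : g.linearIsometryEquiv x = g x - g 0 := by
  rw [Isom.apply_eq g x]; simp

/-- An `n`-space group: a discrete group of isometries of an `n`-dimensional Euclidean space
whose orbit space (with the quotient topology) is compact. -/
structure IsSpaceGroup (n : ℕ) (Γ : Subgroup (Isom E)) : Prop where
  finrank_eq : Module.finrank ℝ E = n
  discrete : DiscreteTopology Γ
  compact : CompactSpace (MulAction.orbitRel.Quotient Γ E)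

/-- `Span(H)`: the vector subspace spanned by the `a` with `a + I ∈ H`. -/
def spanOf (H : Subgroup (Isom E)) : Submodule ℝ E :=
  Submodule.span ℝ {a : E | AffineIsometryEquiv.constVAdd ℝ E a ∈ H}

/-- `N` is a complete normal subgroup of `Γ`: it is a normal subgroup of `Γ` and, with
`V = Span(N)`, it consists of all `a + A ∈ Γ` such that `a ∈ V` and `A` fixes `V^⊥` pointwise. -/
structure IsCompleteNormal (N Γ : Subgroup (Isom E)) : Prop where
  le : N ≤ Γ
  normal : (N.subgroupOf Γ).Normal
  mem_iff : ∀ g ∈ Γ, g ∈ N ↔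
    g 0 ∈ spanOf N ∧ ∀ w ∈ (spanOf N)ᗮ, g.linearIsometryEquiv w = w

/-! ### The orbit space `E/Γ` and its isometries -/

/-- The orbit space `E/Γ`, as a metric space. -/
def OrbitSpace (Γ : Subgroup (Isom E)) : Type _ := MulAction.orbitRel.Quotient Γ E

/-- The orbit `Γ x`. -/
def OrbitSpace.mk (Γ : Subgroup (Isom E)) (x : E) : OrbitSpace Γ :=
  (Quotient.mk'' x : MulAction.orbitRel.Quotient Γ E)

theorem OrbitSpace.mk_surjective (Γ : Subgroup (Isom E)) :
    Function.Surjective (OrbitSpace.mk Γ) := Quotient.mk''_surjective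

theorem OrbitSpace.mk_eq_mk {Γ : Subgroup (Isom E)} {x y : E} :
    OrbitSpace.mk Γ x = OrbitSpace.mk Γ y ↔ ∃ g : Γ, (g : Isom E) y = x := by
  change (Quotient.mk'' x : MulAction.orbitRel.Quotient Γ E) = Quotient.mk'' y ↔ _
  rw [Quotient.eq'', MulAction.orbitRel_apply, MulAction.mem_orbit_iff]
  rfl

/-- The distance between the orbits of `x` and of `y`. -/
def orbitDist (Γ : Subgroup (Isom E)) (x y : E) : ℝ := ⨅ g : Γ, dist x ((g : Isom E) y)

theorem orbitDist_bddBelow (Γ : Subgroup (Isom E)) (x y : E) :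
    BddBelow (Set.range fun g : Γ => dist x ((g : Isom E) y)) :=
  ⟨0, by rintro _ ⟨g, rfl⟩; exact dist_nonneg⟩

theorem orbitDist_le (Γ : Subgroup (Isom E)) (x y : E) (g : Γ) :
    orbitDist Γ x y ≤ dist x ((g : Isom E) y) :=
  ciInf_le (orbitDist_bddBelow Γ x y) g

theorem orbitDist_comm (Γ : Subgroup (Isom E)) (x y : E) : orbitDist Γ x y = orbitDist Γ y x := by
  have key : ∀ x y : E, orbitDist Γ x y ≤ orbitDist Γ y x := by
    intro x y
    refine le_ciInf fun g => (orbitDist_le Γ x y g⁻¹).trans (le_of_eq ?_)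
    have h := (g : Isom E).dist_map x (((g⁻¹ : Γ) : Isom E) y)
    rw [← h, dist_comm]
    simp
  exact le_antisymm (key x y) (key y x)

theorem orbitDist_smul_right (Γ : Subgroup (Isom E)) (x y : E) (h : Γ) :
    orbitDist Γ x ((h : Isom E) y) = orbitDist Γ x y := by
  apply le_antisymm
  · refine le_ciInf fun g => (orbitDist_le Γ x _ (g * h⁻¹)).trans (le_of_eq ?_)
    simp
  · exact le_ciInf fun g => orbitDist_le Γ x y (g * h)

theorem orbitDist_smul_left (Γ : Subgroup (Isom E)) (x y : E) (h : Γ) :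
    orbitDist Γ ((h : Isom E) x) y = orbitDist Γ x y := by
  rw [orbitDist_comm, orbitDist_smul_right, orbitDist_comm]

theorem orbitDist_triangle (Γ : Subgroup (Isom E)) (x y z : E) :
    orbitDist Γ x z ≤ orbitDist Γ x y + orbitDist Γ y z := by
  refine le_ciInf_add_ciInf fun g h => (orbitDist_le Γ x z (g * h)).trans ?_
  have := (g : Isom E).dist_map y ((h : Isom E) z)
  rw [← this]
  exact dist_triangle x ((g : Isom E) y) _

/-- The distance between two orbits is the distance between them as subsets of `E`.
For discrete `Γ` this is a metric. -/
instance OrbitSpace.instPseudoMetricSpace (Γ : Subgroup (Isom E)) :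
    PseudoMetricSpace (OrbitSpace Γ) where
  dist p q := Quotient.liftOn₂' p q (orbitDist Γ) (by
    rintro a₁ b₁ a₂ b₂ ⟨g, rfl⟩ ⟨h, rfl⟩
    exact (orbitDist_smul_left Γ a₂ _ g).trans (orbitDist_smul_right Γ a₂ b₂ h))
  dist_self p := by
    induction p using Quotient.inductionOn' with | _ x
    refine le_antisymm ?_ (Real.iInf_nonneg fun _ => dist_nonneg)
    exact (orbitDist_le Γ x x 1).trans (by simp)
  dist_comm p q := by
    induction p using Quotient.inductionOn' with | _ x
    induction q using Quotient.inductionOn' with | _ y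
    exact orbitDist_comm Γ x y
  dist_triangle p q r := by
    induction p using Quotient.inductionOn' with | _ x
    induction q using Quotient.inductionOn' with | _ y
    induction r using Quotient.inductionOn' with | _ z
    exact orbitDist_triangle Γ x y z

theorem OrbitSpace.dist_mk (Γ : Subgroup (Isom E)) (x y : E) :
    dist (OrbitSpace.mk Γ x) (OrbitSpace.mk Γ y) = ⨅ g : Γ, dist x ((g : Isom E) y) := rfl

/-- The normalizer of `Γ` in `Isom(E)`. -/
abbrev isomNormalizer (Γ : Subgroup (Isom E)) : Subgroup (Isom E) :=
  Subgroup.normalizer (Γ : Set (Isom E))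

theorem isomNormalizer.conj_mem {Γ : Subgroup (Isom E)} (a : isomNormalizer Γ) (g : Γ) :
    (a : Isom E) * g * (a : Isom E)⁻¹ ∈ Γ :=
  (Subgroup.mem_normalizer_iff.1 a.2 g).1 g.2

/-- The map `a_⋆ : E/Γ → E/Γ`, `a_⋆(Γ x) = Γ a(x)`, for `a` normalizing `Γ`. -/
def starFun (Γ : Subgroup (Isom E)) (a : isomNormalizer Γ) (p : OrbitSpace Γ) : OrbitSpace Γ :=
  Quotient.liftOn' p (fun x => OrbitSpace.mk Γ ((a : Isom E) x)) (by
    rintro _ y ⟨g, rfl⟩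
    refine OrbitSpace.mk_eq_mk.2 ⟨⟨_, isomNormalizer.conj_mem a g⟩, ?_⟩
    simp [Isom.subgroup_smul_def])

theorem starFun_mk (Γ : Subgroup (Isom E)) (a : isomNormalizer Γ) (x : E) :
    starFun Γ a (OrbitSpace.mk Γ x) = OrbitSpace.mk Γ ((a : Isom E) x) := rfl

theorem starFun_dist_le (Γ : Subgroup (Isom E)) (a : isomNormalizer Γ) (p q : OrbitSpace Γ) :
    dist (starFun Γ a p) (starFun Γ a q) ≤ dist p q := by
  obtain ⟨x, rfl⟩ := OrbitSpace.mk_surjective Γ p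
  obtain ⟨y, rfl⟩ := OrbitSpace.mk_surjective Γ q
  rw [starFun_mk, starFun_mk, OrbitSpace.dist_mk, OrbitSpace.dist_mk]
  refine le_ciInf fun g => (orbitDist_le Γ _ _ ⟨_, isomNormalizer.conj_mem a g⟩).trans
    (le_of_eq ?_)
  simp

theorem starFun_mul (Γ : Subgroup (Isom E)) (a b : isomNormalizer Γ) (p : OrbitSpace Γ) :
    starFun Γ (a * b) p = starFun Γ a (starFun Γ b p) := by
  obtain ⟨x, rfl⟩ := OrbitSpace.mk_surjective Γ p
  rfl

theorem starFun_one (Γ : Subgroup (Isom E)) (p : OrbitSpace Γ) : starFun Γ 1 p = p := by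
  obtain ⟨x, rfl⟩ := OrbitSpace.mk_surjective Γ p
  rfl

/-- The homomorphism `Φ : N_E(Γ) → Isom(E/Γ)`, `a ↦ a_⋆`, where `a_⋆(Γ x) = Γ a(x)`. -/
def starHom (Γ : Subgroup (Isom E)) : isomNormalizer Γ →* (OrbitSpace Γ ≃ᵢ OrbitSpace Γ) where
  toFun a :=
    { toFun := starFun Γ a
      invFun := starFun Γ a⁻¹
      left_inv := fun p => by rw [← starFun_mul, inv_mul_cancel, starFun_one]
      right_inv := fun p => by rw [← starFun_mul, mul_inv_cancel, starFun_one]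
      isometry_toFun := Isometry.of_dist_eq fun p q => by
        refine le_antisymm (starFun_dist_le Γ a p q) ?_
        have h := starFun_dist_le Γ a⁻¹ (starFun Γ a p) (starFun Γ a q)
        simpa only [← starFun_mul, inv_mul_cancel, starFun_one] using h }
  map_one' := IsometryEquiv.ext fun p => starFun_one Γ p
  map_mul' a b := IsometryEquiv.ext fun p => starFun_mul Γ a b p

theorem starHom_mk (Γ : Subgroup (Isom E)) (a : isomNormalizer Γ) (x : E) :
    starHom Γ a (OrbitSpace.mk Γ x) = OrbitSpace.mk Γ ((a : Isom E) x) := rfl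

end General

/-! ### Products of Euclidean spaces -/

section Product

/-- The Euclidean (orthogonal) product `V × W`. -/
abbrev EProd (V W : Type*) : Type _ := WithLp 2 (V × W)

variable {V W : Type*} [NormedAddCommGroup V] [InnerProductSpace ℝ V]
  [NormedAddCommGroup W] [InnerProductSpace ℝ W]

/-- The point `(v, w)` of `V × W`. -/
abbrev EProd.pair (v : V) (w : W) : EProd V W := WithLp.toLp 2 (v, w)

/-- The diagonal isometry `(v, w) ↦ (α v, β w)` of `V × W`. -/
def prodIsom (α : Isom V) (β : Isom W) : Isom (EProd V W) :=
  AffineIsometryEquiv.mk' (fun x => EProd.pair (α x.fst) (β x.snd))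
    (LinearIsometryEquiv.withLpProdCongr 2 α.linearIsometryEquiv β.linearIsometryEquiv) 0
    (fun x => by
      apply (WithLp.equiv 2 (V × W)).injective
      refine Prod.ext ?_ ?_
      · simpa using Isom.apply_eq α x.fst
      · simpa using Isom.apply_eq β x.snd)

theorem prodIsom_apply (α : Isom V) (β : Isom W) (x : EProd V W) :
    prodIsom α β x = EProd.pair (α x.fst) (β x.snd) := rfl

variable (V W) in
/-- The homomorphism `Isom(V) × Isom(W) → Isom(V × W)`. -/
def prodHom : Isom V × Isom W →* Isom (EProd V W) where
  toFun p := prodIsom p.1 p.2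
  map_one' := AffineIsometryEquiv.ext fun _ => rfl
  map_mul' _ _ := AffineIsometryEquiv.ext fun _ => rfl

theorem prodHom_apply (p : Isom V × Isom W) (x : EProd V W) :
    prodHom V W p x = EProd.pair (p.1 x.fst) (p.2 x.snd) := rfl

theorem prodHom_injective : Function.Injective (prodHom V W) := by
  intro p q h
  refine Prod.ext (AffineIsometryEquiv.ext fun v => ?_) (AffineIsometryEquiv.ext fun w => ?_)
  · have := congrArg (fun g : Isom (EProd V W) => (g (EProd.pair v 0)).fst) h
    simpa [prodHom_apply] using this
  · have := congrArg (fun g : Isom (EProd V W) => (g (EProd.pair 0 w)).snd) h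
    simpa [prodHom_apply] using this

/-- The extension of `M ≤ Isom(V)` to a group of isometries of `V × W`: `a + A ∈ M` acts as
`(v, w) ↦ (a + A v, w)`. -/
def extend (W : Type*) [NormedAddCommGroup W] [InnerProductSpace ℝ W]
    (M : Subgroup (Isom V)) : Subgroup (Isom (EProd V W)) :=
  M.map ((prodHom V W).comp (MonoidHom.inl (Isom V) (Isom W)))

/-- The two components of a diagonal isometry of `V × W`. -/
def splitHom : (prodHom V W).range ≃* Isom V × Isom W :=
  (MonoidHom.ofInjective prodHom_injective).symm

theorem prodHom_splitHom (g : (prodHom V W).range) :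
    prodHom V W (splitHom g) = (g : Isom (EProd V W)) :=
  congrArg Subtype.val ((MonoidHom.ofInjective prodHom_injective).apply_symm_apply g)

theorem mem_extend {M : Subgroup (Isom V)} {α : Isom V} {β : Isom W} :
    prodHom V W (α, β) ∈ extend W M ↔ α ∈ M ∧ β = 1 := by
  constructor
  · rintro ⟨μ, hμ, h⟩
    have h' : (μ, (1 : Isom W)) = (α, β) := prodHom_injective h
    obtain ⟨rfl, rfl⟩ := Prod.mk.inj h'
    exact ⟨hμ, rfl⟩
  · rintro ⟨hα, rfl⟩
    exact ⟨α, hα, rfl⟩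

variable (V W) in
/-- `V = V × {0}` as a subspace of `V × W`. -/
def firstFactor : Submodule ℝ (EProd V W) where
  carrier := {x | x.snd = 0}
  add_mem' {x y} hx hy := by
    have hx' : x.snd = 0 := hx
    have hy' : y.snd = 0 := hy
    simp [hx', hy']
  zero_mem' := rfl
  smul_mem' c x hx := by
    have hx' : x.snd = 0 := hx
    simp [hx']

theorem mem_firstFactor {x : EProd V W} : x ∈ firstFactor V W ↔ x.snd = 0 := Iff.rfl

theorem mem_firstFactor_orthogonal {x : EProd V W} : x ∈ (firstFactor V W)ᗮ ↔ x.fst = 0 := by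
  rw [Submodule.mem_orthogonal]
  constructor
  · intro h
    have := h (EProd.pair x.fst 0) rfl
    simpa [WithLp.prod_inner_apply] using this
  · intro h u hu
    have hu' : u.snd = 0 := hu
    simp [WithLp.prod_inner_apply, h, hu']

/-- The linear part of an element of `Γ` leaves the span of a normal subgroup invariant. -/
theorem linear_mem_spanOf {E : Type*} [NormedAddCommGroup E] [InnerProductSpace ℝ E]
    {N Γ : Subgroup (Isom E)} (hN : IsCompleteNormal N Γ) {g : Isom E} (hg : g ∈ Γ)
    {x : E} (hx : x ∈ spanOf N) : g.linearIsometryEquiv x ∈ spanOf N := by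
  unfold spanOf at hx ⊢
  induction hx using Submodule.span_induction with
  | mem a ha =>
    apply Submodule.subset_span
    have h1 := hN.normal.conj_mem ⟨_, hN.le ha⟩ (Subgroup.mem_subgroupOf.2 ha) ⟨g, hg⟩
    have h2 : g * AffineIsometryEquiv.constVAdd ℝ E a * g⁻¹ ∈ N := Subgroup.mem_subgroupOf.1 h1
    have h3 : g * AffineIsometryEquiv.constVAdd ℝ E a * g⁻¹ =
        AffineIsometryEquiv.constVAdd ℝ E (g.linearIsometryEquiv a) := by
      ext y
      have := g.map_vadd (g.symm y) a
      simpa using this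
    rw [h3] at h2
    exact h2
  | zero => simp
  | add y z _ _ hy hz => rw [map_add]; exact Submodule.add_mem _ hy hz
  | smul c y _ hy => rw [map_smul]; exact Submodule.smul_mem _ c hy

variable [FiniteDimensional ℝ V] [FiniteDimensional ℝ W]

/-- An isometry `b + B` of `V × W` with `B V ⊆ V` is diagonal. -/
theorem mem_range_prodHom {g : Isom (EProd V W)}
    (h : ∀ x ∈ firstFactor V W, g.linearIsometryEquiv x ∈ firstFactor V W) :
    g ∈ (prodHom V W).range := by
  set B := g.linearIsometryEquiv with hB
  have hmap : (firstFactor V W).map (B.toLinearEquiv : EProd V W →ₗ[ℝ] EProd V W)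
      = firstFactor V W := by
    apply Submodule.eq_of_le_of_finrank_eq
    · rintro _ ⟨x, hx, rfl⟩
      exact h x hx
    · exact LinearEquiv.finrank_map_eq B.toLinearEquiv _
  have h1 : ∀ v : V, (B (EProd.pair v 0)).snd = 0 := fun v => h _ rfl
  have h2 : ∀ w : W, (B (EProd.pair 0 w)).fst = 0 := by
    intro w
    rw [← mem_firstFactor_orthogonal, Submodule.mem_orthogonal]
    intro u hu
    rw [← hmap] at hu
    obtain ⟨x, hx, rfl⟩ := hu
    have hx' : x.snd = 0 := hx
    have : inner ℝ (B x) (B (EProd.pair 0 w)) = 0 := by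
      rw [B.inner_map_map]
      simp [WithLp.prod_inner_apply, hx']
    exact this
  let A : V →ₗᵢ[ℝ] V :=
    { toFun := fun v => (B (EProd.pair v 0)).fst
      map_add' := fun v v' => by
        have : (EProd.pair (v + v') 0 : EProd V W) = EProd.pair v 0 + EProd.pair v' 0 := by
          rw [← WithLp.toLp_add]; simp
        rw [this, map_add]; simp
      map_smul' := fun c v => by
        have : (EProd.pair (c • v) 0 : EProd V W) = c • EProd.pair v 0 := by
          rw [← WithLp.toLp_smul]; simp
        rw [this, map_smul]; simp
      norm_map' := fun v => by
        have e := B.norm_map (EProd.pair v 0)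
        rw [WithLp.prod_norm_eq_of_L2, WithLp.prod_norm_eq_of_L2, h1 v] at e
        simpa using e }
  let C : W →ₗᵢ[ℝ] W :=
    { toFun := fun w => (B (EProd.pair 0 w)).snd
      map_add' := fun w w' => by
        have : (EProd.pair 0 (w + w') : EProd V W) = EProd.pair 0 w + EProd.pair 0 w' := by
          rw [← WithLp.toLp_add]; simp
        rw [this, map_add]; simp
      map_smul' := fun c w => by
        have : (EProd.pair 0 (c • w) : EProd V W) = c • EProd.pair 0 w := by
          rw [← WithLp.toLp_smul]; simp
        rw [this, map_smul]; simp
      norm_map' := fun w => by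
        have e := B.norm_map (EProd.pair 0 w)
        rw [WithLp.prod_norm_eq_of_L2, WithLp.prod_norm_eq_of_L2, h2 w] at e
        simpa using e }
  let α : Isom V := AffineIsometryEquiv.mk' (fun v => A v + (g 0).fst)
    (A.toLinearIsometryEquiv rfl) 0 (fun v => by simp)
  let β : Isom W := AffineIsometryEquiv.mk' (fun w => C w + (g 0).snd)
    (C.toLinearIsometryEquiv rfl) 0 (fun w => by simp)
  refine ⟨(α, β), AffineIsometryEquiv.ext fun x => ?_⟩
  have hx : x = EProd.pair x.fst 0 + EProd.pair 0 x.snd := by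
    rw [← WithLp.toLp_add]
    apply (WithLp.equiv 2 (V × W)).injective
    refine Prod.ext ?_ ?_
    · exact (add_zero x.fst).symm
    · exact (zero_add x.snd).symm
  have e1 : g x = B x + g 0 := Isom.apply_eq g x
  have e2 : B x = B (EProd.pair x.fst 0) + B (EProd.pair 0 x.snd) := by
    conv_lhs => rw [hx, map_add]
  rw [prodHom_apply, e1, e2]
  apply (WithLp.equiv 2 (V × W)).injective
  refine Prod.ext ?_ ?_
  · have := h2 x.snd
    simp only [WithLp.equiv_apply, WithLp.ofLp_add, Prod.fst_add]
    change (B (EProd.pair x.fst 0)).fst + (g 0).fst = _ + (B (EProd.pair 0 x.snd)).fst + _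
    rw [this, add_zero]; rfl
  · have := h1 x.fst
    simp only [WithLp.equiv_apply, WithLp.ofLp_add, Prod.snd_add]
    change (B (EProd.pair 0 x.snd)).snd + (g 0).snd = (B (EProd.pair x.fst 0)).snd + _ + _
    rw [this, zero_add]; rfl

/-! ### The action of `Γ/N` when `Span(N) = V` -/

variable {M : Subgroup (Isom V)} {Γ : Subgroup (Isom (EProd V W))}

theorem le_range_prodHom (hV : spanOf (extend W M) = firstFactor V W)
    (hN : IsCompleteNormal (extend W M) Γ) : Γ ≤ (prodHom V W).range := by
  intro g hg
  apply mem_range_prodHom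
  intro x hx
  rw [← hV] at hx ⊢
  exact linear_mem_spanOf hN hg hx

/-- The homomorphism `γ ↦ (γ̄, γ')`; see `componentsHom_spec`. -/
def componentsHom (hV : spanOf (extend W M) = firstFactor V W)
    (hN : IsCompleteNormal (extend W M) Γ) : Γ →* Isom V × Isom W :=
  splitHom.toMonoidHom.comp (Subgroup.inclusion (le_range_prodHom hV hN))

/-- The homomorphism `γ ↦ γ̄ ∈ Isom(V)`. -/
def barHom (hV : spanOf (extend W M) = firstFactor V W)
    (hN : IsCompleteNormal (extend W M) Γ) : Γ →* Isom V :=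
  (MonoidHom.fst _ _).comp (componentsHom hV hN)

/-- The homomorphism `γ ↦ γ' ∈ Isom(W)`. -/
def primeHom (hV : spanOf (extend W M) = firstFactor V W)
    (hN : IsCompleteNormal (extend W M) Γ) : Γ →* Isom W :=
  (MonoidHom.snd _ _).comp (componentsHom hV hN)

/-- The group `Γ' = {γ' : γ ∈ Γ}`. -/
def primeGroup (hV : spanOf (extend W M) = firstFactor V W)
    (hN : IsCompleteNormal (extend W M) Γ) : Subgroup (Isom W) :=
  (primeHom hV hN).range

/-- `γ(v, w) = (γ̄ v, γ' w)`. -/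
theorem componentsHom_spec (hV : spanOf (extend W M) = firstFactor V W)
    (hN : IsCompleteNormal (extend W M) Γ) (γ : Γ) (v : V) (w : W) :
    (γ : Isom (EProd V W)) (EProd.pair v w) =
      EProd.pair (barHom hV hN γ v) (primeHom hV hN γ w) := by
  have := prodHom_splitHom (Subgroup.inclusion (le_range_prodHom hV hN) γ)
  exact (congrArg (fun g : Isom (EProd V W) => g (EProd.pair v w)) this).symm

theorem components_unique (hV : spanOf (extend W M) = firstFactor V W)
    (hN : IsCompleteNormal (extend W M) Γ) (γ : Γ) (α : Isom V) (β : Isom W)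
    (h : (γ : Isom (EProd V W)) = prodHom V W (α, β)) :
    barHom hV hN γ = α ∧ primeHom hV hN γ = β := by
  have h1 : prodHom V W (barHom hV hN γ, primeHom hV hN γ) = prodHom V W (α, β) :=
    (prodHom_splitHom (Subgroup.inclusion (le_range_prodHom hV hN) γ)).trans h
  exact Prod.mk.inj (prodHom_injective h1)

theorem prodHom_components (hV : spanOf (extend W M) = firstFactor V W)
    (hN : IsCompleteNormal (extend W M) Γ) (γ : Γ) :
    prodHom V W (barHom hV hN γ, primeHom hV hN γ) = (γ : Isom (EProd V W)) :=
  prodHom_splitHom (Subgroup.inclusion (le_range_prodHom hV hN) γ)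

theorem mem_extend_iff_components (hV : spanOf (extend W M) = firstFactor V W)
    (hN : IsCompleteNormal (extend W M) Γ) (γ : Γ) :
    (γ : Isom (EProd V W)) ∈ extend W M ↔ barHom hV hN γ ∈ M ∧ primeHom hV hN γ = 1 := by
  rw [← prodHom_components hV hN γ, mem_extend]

/-- The kernel of `γ ↦ γ'` is `N`, because `N` is complete. -/
theorem subgroupOf_eq_ker (hV : spanOf (extend W M) = firstFactor V W)
    (hN : IsCompleteNormal (extend W M) Γ) :
    (extend W M).subgroupOf Γ = (primeHom hV hN).ker := by
  ext γ
  rw [Subgroup.mem_subgroupOf, MonoidHom.mem_ker]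
  refine ⟨fun h => ((mem_extend_iff_components hV hN γ).1 h).2, fun h => ?_⟩
  have hγ : ∀ x : EProd V W, (γ : Isom (EProd V W)) x =
      EProd.pair (barHom hV hN γ x.fst) x.snd := by
    intro x
    rw [← prodHom_components hV hN γ, prodHom_apply, h]; rfl
  rw [hN.mem_iff _ γ.2, hV]
  refine ⟨?_, fun w hw => ?_⟩
  · rw [mem_firstFactor, hγ]; rfl
  · rw [mem_firstFactor_orthogonal] at hw
    rw [Isom.linear_eq, hγ, hγ, hw]
    apply (WithLp.equiv 2 (V × W)).injective
    refine Prod.ext ?_ ?_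
    · simpa using hw.symm
    · simp

/-- `γ̄` normalizes `M`, because `γ` normalizes `N`. -/
theorem barHom_mem_normalizer (hV : spanOf (extend W M) = firstFactor V W)
    (hN : IsCompleteNormal (extend W M) Γ) (γ : Γ) : barHom hV hN γ ∈ isomNormalizer M := by
  have key : ∀ (γ : Γ) (μ : Isom V), μ ∈ M → barHom hV hN γ * μ * (barHom hV hN γ)⁻¹ ∈ M := by
    intro γ μ hμ
    have hμ' : prodHom V W (μ, 1) ∈ extend W M := mem_extend.2 ⟨hμ, rfl⟩
    have h1 := hN.normal.conj_mem ⟨_, hN.le hμ'⟩ (Subgroup.mem_subgroupOf.2 hμ') γ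
    have h2 := ((mem_extend_iff_components hV hN _).1 (Subgroup.mem_subgroupOf.1 h1)).1
    rwa [map_mul, map_mul, map_inv,
      (components_unique hV hN ⟨_, hN.le hμ'⟩ μ 1 rfl).1] at h2
  refine Subgroup.mem_normalizer_iff.2 fun μ => ⟨key γ μ, fun h => ?_⟩
  have := key γ⁻¹ _ h
  simpa [mul_assoc] using this

/-- The homomorphism `Γ → Isom(V/M)`, `γ ↦ γ̄_⋆`. -/
def barStarHom (hV : spanOf (extend W M) = firstFactor V W)
    (hN : IsCompleteNormal (extend W M) Γ) : Γ →* (OrbitSpace M ≃ᵢ OrbitSpace M) :=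
  (starHom M).comp ((barHom hV hN).codRestrict (isomNormalizer M) (barHom_mem_normalizer hV hN))

/-- The homomorphism `Ξ : Γ/N → Isom(V/N)`, `Ξ(N γ) = γ̄_⋆`, induced by the action of `Γ/N` on
`V/N`. The group `N` acts on `V` as `M` does, so `V/N` is `V/M`. -/
def Xi (hV : spanOf (extend W M) = firstFactor V W) (hN : IsCompleteNormal (extend W M) Γ) :
    haveI := hN.normal
    Γ ⧸ (extend W M).subgroupOf Γ →* (OrbitSpace M ≃ᵢ OrbitSpace M) :=
  haveI := hN.normal
  QuotientGroup.lift _ (barStarHom hV hN) (by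
    intro γ hγ
    have hm := ((mem_extend_iff_components hV hN γ).1 (Subgroup.mem_subgroupOf.1 hγ)).1
    refine IsometryEquiv.ext fun p => ?_
    obtain ⟨x, rfl⟩ := OrbitSpace.mk_surjective M p
    exact OrbitSpace.mk_eq_mk.2 ⟨⟨_, hm⟩, rfl⟩)

/-- The isomorphism `P : Γ/N → Γ'`, `P(N γ) = γ'`. -/
def PIso (hV : spanOf (extend W M) = firstFactor V W) (hN : IsCompleteNormal (extend W M) Γ) :
    haveI := hN.normal
    Γ ⧸ (extend W M).subgroupOf Γ ≃* primeGroup hV hN :=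
  haveI := hN.normal
  (QuotientGroup.quotientMulEquivOfEq (subgroupOf_eq_ker hV hN)).trans
    (QuotientGroup.quotientKerEquivRange (primeHom hV hN))

theorem Xi_mk (hV : spanOf (extend W M) = firstFactor V W)
    (hN : IsCompleteNormal (extend W M) Γ) (γ : Γ) (v : V) :
    Xi hV hN (QuotientGroup.mk γ) (OrbitSpace.mk M v) = OrbitSpace.mk M (barHom hV hN γ v) := rfl

theorem PIso_mk (hV : spanOf (extend W M) = firstFactor V W)
    (hN : IsCompleteNormal (extend W M) Γ) (γ : Γ) :
    (PIso hV hN (QuotientGroup.mk γ) : Isom W) = primeHom hV hN γ := rfl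

end Product

end

/-! Write `N` for the copy of `M` acting on the first factor. The group is forced: it must consist
of all pairs `(α, δ)` with `δ ∈ Δ`, `α` in the normalizer of `M`, and `α_⋆ = Θ(δ)`, a fibre product
of the normalizer and `Δ` over `Isom(E^m/M)`. If `Γ` has the three properties, its elements are such
pairs. Conversely, given a pair `(α, δ)`, choose `γ ∈ Γ` with `γ' = δ`. Then `α` and `γ̄` induce the
same isometry of `E^m/M`, so they differ by an element of `M`, and `(α, δ)` lies in `N γ ⊆ Γ`.

That this fibre product is a space group with the required properties rests on three facts.

The translations of a space group span (Bieberbach; `IsSpaceGroup.spanOf_eq_top`), so `Span(N)` is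
the whole first factor. The argument is a minimal-displacement one: a non-translation with linear
part near `1` and a nearly pure translation in its direction of maximal rotation would have a
commutator contradicting minimality.

The homomorphism from the normalizer of `M` to `Isom(E^m/M)` has kernel `M`
(`exists_eq_mul_of_starHom_eq`). Two isometries with the same image agree up to `M` at each point,
with countably many candidates for the element of `M`; by Baire one candidate works everywhere.

The same homomorphism is surjective (`starHom_surjective`), so every `δ` occurs in a pair. This is
the deepest point, because `M` may have torsion and the orbit map need not be a covering. An
isometry `f` of the orbit space preserves the points with trivial stabilizer, since these have a
metric description, and near such a point it lifts to an isometry `α`. The lift is continued along a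
segment to a generic endpoint. Such a segment meets the fixed sets of group elements only where the
stabilizer consists of `1` and one reflection, and there continuation is possible because `α`
carries the mirror to a mirror.

Discreteness and compactness of the fibre product then follow coordinate by coordinate. -/

namespace Isom

/-! ### Linear parts, discreteness as finiteness, compactness as coboundedness -/

variable {E : Type*} [NormedAddCommGroup E] [InnerProductSpace ℝ E]

@[simp]
theorem mul_apply (g h : Isom E) (x : E) : (g * h) x = g (h x) := rfl

@[simp]
theorem inv_apply_self (g : Isom E) (x : E) : g⁻¹ (g x) = x := g.symm_apply_apply x

@[simp]
theorem apply_inv_self (g : Isom E) (x : E) : g (g⁻¹ x) = x := g.apply_symm_apply x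

/-- The linear part `A` of the isometry `a + A`, as a continuous linear map. -/
noncomputable def lin (g : Isom E) : E →L[ℝ] E := (g.linearIsometryEquiv : E →L[ℝ] E)

theorem lin_apply (g : Isom E) (x : E) : lin g x = g x - g 0 := linear_eq g x

theorem apply_eq_lin (g : Isom E) (x : E) : g x = lin g x + g 0 := apply_eq g x

theorem norm_lin_apply (g : Isom E) (x : E) : ‖lin g x‖ = ‖x‖ := g.linearIsometryEquiv.norm_map x

theorem inner_lin_apply (g : Isom E) (x y : E) : inner ℝ (lin g x) (lin g y) = inner ℝ x y :=
  g.linearIsometryEquiv.inner_map_map x y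

theorem norm_lin_le (g : Isom E) : ‖lin g‖ ≤ 1 :=
  ContinuousLinearMap.opNorm_le_bound _ zero_le_one fun x => by rw [norm_lin_apply, one_mul]

theorem lin_mul (g h : Isom E) : lin (g * h) = lin g * lin h := by
  ext x
  simp only [lin_apply, mul_apply, mul_apply_eq_comp]
  rw [apply_eq_lin g (h x), apply_eq_lin g (h 0), ← lin_apply h x, add_sub_add_right_eq_sub,
    ← map_sub, lin_apply h x, ← lin_apply g]

theorem lin_one : lin (1 : Isom E) = 1 := by
  ext x
  simp [lin_apply]

theorem lin_inv_apply_lin (g : Isom E) (x : E) : lin g⁻¹ (lin g x) = x := by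
  rw [← mul_apply_eq_comp, ← lin_mul, inv_mul_cancel, lin_one]; rfl

theorem lin_apply_lin_inv (g : Isom E) (x : E) : lin g (lin g⁻¹ x) = x := by
  rw [← mul_apply_eq_comp, ← lin_mul, mul_inv_cancel, lin_one]; rfl

theorem apply_sub (g : Isom E) (x y : E) : g x - g y = lin g (x - y) := by
  rw [apply_eq_lin g x, apply_eq_lin g y, map_sub]; abel

theorem ext_lin {g h : Isom E} (h1 : lin g = lin h) (h0 : g 0 = h 0) : g = h :=
  AffineIsometryEquiv.ext fun x => by rw [apply_eq_lin g, apply_eq_lin h, h1, h0]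

theorem isInducing_toContinuousMap :
    Topology.IsInducing (fun g : Isom E => (⟨g, g.continuous⟩ : C(E, E))) := ⟨rfl⟩

theorem continuous_eval (x : E) : Continuous fun g : Isom E => g x :=
  (continuous_eval_const (F := C(E, E)) x).comp isInducing_toContinuousMap.continuous

instance : T2Space (Isom E) :=
  T2Space.of_injective_continuous (f := fun g : Isom E => (g : E → E))
    (fun _ _ h => AffineIsometryEquiv.ext (congrFun h))
    (continuous_pi continuous_eval)

instance (Γ : Subgroup (Isom E)) : ContinuousConstSMul Γ E :=
  ⟨fun g => (g : Isom E).continuous⟩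

/-- Isometries close to the identity at the origin and in their linear part are close to the
identity in the compact-open topology. -/
theorem exists_eq_one_of_discrete {Γ : Subgroup (Isom E)} [DiscreteTopology Γ] :
    ∃ η > 0, ∀ g ∈ Γ, ‖g 0‖ < η → ‖lin g - 1‖ < η → g = 1 := by
  -- Joint continuity of evaluation makes `Ψ` continuous into the compact-open topology, so
  -- closeness in norm of the pair (value at `0`, linear part) suffices for closeness of isometries.
  let Ψ : E × (E →L[ℝ] E) → C(E, E) := fun p => ⟨fun x => p.2 x + p.1, by fun_prop⟩
  have hΨ : Continuous Ψ := ContinuousMap.continuous_of_continuous_uncurry _ (by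
    change Continuous fun q : (E × (E →L[ℝ] E)) × E => q.1.2 q.2 + q.1.1
    fun_prop)
  have h1 : IsOpen ({1} : Set Γ) := isOpen_discrete _
  obtain ⟨U, hU, hU1⟩ := isOpen_induced_iff.1 h1
  obtain ⟨U', hU', rfl⟩ := isInducing_toContinuousMap.isOpen_iff.1 hU
  have hmem : ∀ g : Isom E, Ψ (g 0, lin g) = ⟨g, g.continuous⟩ := fun g =>
    ContinuousMap.ext fun x => (apply_eq_lin g x).symm
  have hnear : Ψ ⁻¹' U' ∈ 𝓝 ((0 : E), (1 : E →L[ℝ] E)) := by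
    refine (hU'.preimage hΨ).mem_nhds ?_
    have : (1 : Γ) ∈ ({1} : Set Γ) := rfl
    rw [← hU1] at this
    have h2 := hmem (1 : Isom E)
    rw [lin_one] at h2
    change Ψ ((1 : Isom E) 0, 1) ∈ U'
    rw [h2]
    exact this
  obtain ⟨η, hη, hball⟩ := Metric.mem_nhds_iff.1 hnear
  refine ⟨η, hη, fun g hg h0 hl => ?_⟩
  have hg' : (g 0, lin g) ∈ Metric.ball ((0 : E), (1 : E →L[ℝ] E)) η := by
    rw [Metric.mem_ball, Prod.dist_eq, max_lt_iff, dist_zero_right, dist_eq_norm]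
    exact ⟨h0, hl⟩
  have h3 := hball hg'
  rw [Set.mem_preimage, hmem] at h3
  have : (⟨g, hg⟩ : Γ) ∈ ({1} : Set Γ) := by rw [← hU1]; exact h3
  exact congrArg Subtype.val this

/-- A discrete group of isometries of a finite-dimensional space moves the origin to a
bounded set only finitely often. -/
theorem finite_of_discrete [FiniteDimensional ℝ E] (Γ : Subgroup (Isom E)) [DiscreteTopology Γ]
    (R : ℝ) : {g | g ∈ Γ ∧ ‖g 0‖ ≤ R}.Finite := by
  obtain ⟨η, hη, hone⟩ := exists_eq_one_of_discrete (Γ := Γ)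
  by_contra hinf
  -- Pigeonhole: the pairs `F g` lie in a bounded, hence totally bounded, set. Infinitely many would
  -- give distinct `g`, `h` with `F g`, `F h` within `η`, and then `g⁻¹ * h` is close enough to `1`
  -- to equal it.
  let F : Isom E → E × (E →L[ℝ] E) := fun g => (g 0, lin g)
  have htb : TotallyBounded (Metric.closedBall (0 : E × (E →L[ℝ] E)) (max R 1)) :=
    (isCompact_closedBall _ _).totallyBounded
  obtain ⟨t, ht, hcov⟩ := Metric.totallyBounded_iff.1 htb (η / 2) (by positivity)
  have hmaps : ∀ g ∈ {g | g ∈ Γ ∧ ‖g 0‖ ≤ R}, ∃ p ∈ t, dist (F g) p < η / 2 := by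
    rintro g ⟨-, hg⟩
    have : F g ∈ Metric.closedBall (0 : E × (E →L[ℝ] E)) (max R 1) := by
      rw [mem_closedBall_zero_iff, Prod.norm_def]
      exact max_le_max hg (norm_lin_le g)
    simpa using hcov this
  choose! p hp hd using hmaps
  obtain ⟨g, hg, h, hh, hne, heq⟩ :=
    Set.Infinite.exists_ne_map_eq_of_mapsTo hinf (fun g hg => hp g hg) ht
  have hgh : dist (F g) (F h) < η := by
    have h1 := hd g hg
    have h2 := hd h hh
    rw [← heq] at h2
    linarith [dist_triangle_right (F g) (F h) (p g)]
  rw [Prod.dist_eq, max_lt_iff, dist_eq_norm, dist_eq_norm] at hgh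
  refine hne (inv_mul_eq_one.1 (hone (g⁻¹ * h) (Γ.mul_mem (Γ.inv_mem hg.1) hh.1) ?_ ?_))
  · have : (g⁻¹ * h) 0 = lin g⁻¹ (h 0 - g 0) := by
      rw [← apply_sub, inv_apply_self, sub_zero, mul_apply]
    rw [this, norm_lin_apply, norm_sub_rev]
    exact hgh.1
  · have : lin (g⁻¹ * h) - 1 = lin g⁻¹ * (lin h - lin g) := by
      rw [mul_sub, ← lin_mul, ← lin_mul, inv_mul_cancel, lin_one]
    rw [this]
    calc ‖lin g⁻¹ * (lin h - lin g)‖ ≤ ‖lin g⁻¹‖ * ‖lin h - lin g‖ := norm_mul_le _ _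
      _ ≤ 1 * ‖lin h - lin g‖ := by gcongr; exact norm_lin_le _
      _ < η := by rw [one_mul, norm_sub_rev]; exact hgh.2

theorem finite_of_discrete_dist [FiniteDimensional ℝ E] (Γ : Subgroup (Isom E))
    [DiscreteTopology Γ] (x y : E) (R : ℝ) : {g | g ∈ Γ ∧ dist (g x) y ≤ R}.Finite := by
  refine (finite_of_discrete Γ (R + ‖y‖ + ‖x‖)).subset ?_
  rintro g ⟨hg, hd⟩
  refine ⟨hg, ?_⟩
  have h1 : dist (g 0) (g x) = ‖x‖ := by rw [g.dist_map, dist_zero_left]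
  rw [← dist_zero_right]
  linarith [dist_triangle4 (g 0) (g x) y 0, dist_zero_right y]

/-- Moving the origin by less than `R` is an open condition, met by finitely many elements; all but
one of them can be removed, finite sets being closed. -/
theorem discrete_of_finite (Γ : Subgroup (Isom E))
    (h : ∀ R : ℝ, {g | g ∈ Γ ∧ ‖g 0‖ ≤ R}.Finite) : DiscreteTopology Γ := by
  refine discreteTopology_iff_isOpen_singleton.2 fun g => ?_
  let R := ‖(g : Isom E) 0‖ + 1
  let S : Set Γ := {k | ‖(k : Isom E) 0‖ < R}
  have hS : IsOpen S := isOpen_lt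
    ((continuous_eval (E := E) 0).comp continuous_subtype_val).norm continuous_const
  have hfin : S.Finite := by
    refine Set.Finite.of_finite_image ((h R).subset ?_) Subtype.val_injective.injOn
    rintro _ ⟨k, hk, rfl⟩
    exact ⟨k.2, le_of_lt hk⟩
  have : ({g} : Set Γ) = S ∩ (S \ {g})ᶜ := by
    ext k
    simp only [Set.mem_singleton_iff, Set.mem_inter_iff, Set.mem_compl_iff, Set.mem_sdiff]
    constructor
    · rintro rfl
      exact ⟨by simp [S, R], by tauto⟩
    · tauto
  rw [this]
  exact hS.inter (hfin.subset Set.sdiff_subset).isClosed.isOpen_compl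

theorem countable_of_discrete [FiniteDimensional ℝ E] (Γ : Subgroup (Isom E))
    [DiscreteTopology Γ] : Countable Γ := by
  have : (Γ : Set (Isom E)) = ⋃ n : ℕ, {g | g ∈ Γ ∧ ‖g 0‖ ≤ n} := by
    ext g
    simp only [SetLike.mem_coe, Set.mem_iUnion, Set.mem_ofPred_eq, exists_and_left]
    exact ⟨fun hg => ⟨hg, exists_nat_ge _⟩, fun hg => hg.1⟩
  have h : (Γ : Set (Isom E)).Countable := by
    rw [this]
    exact Set.countable_iUnion fun n => (finite_of_discrete Γ n).countable
  exact h.to_subtype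

/-- A group of isometries with compact orbit space moves every point into a fixed ball. -/
theorem exists_norm_le_of_compact (Γ : Subgroup (Isom E))
    [CompactSpace (MulAction.orbitRel.Quotient Γ E)] :
    ∃ d : ℝ, ∀ x : E, ∃ g ∈ Γ, ‖g x‖ ≤ d := by
  let π : E → MulAction.orbitRel.Quotient Γ E := Quotient.mk''
  have hπ : IsOpenMap π := isOpenMap_quotient_mk'_mul
  obtain ⟨n, hn⟩ := isCompact_univ.elim_directed_cover (fun n : ℕ => π '' Metric.ball 0 n)
    (fun n => hπ _ Metric.isOpen_ball)
    (by
      intro p _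
      induction p using Quotient.inductionOn' with | _ x
      obtain ⟨n, hn⟩ := exists_nat_gt ‖x‖
      exact Set.mem_iUnion.2 ⟨n, x, by simpa using hn, rfl⟩)
    (Monotone.directed_le fun a b hab =>
      Set.image_mono (Metric.ball_subset_ball (by exact_mod_cast hab)))
  refine ⟨n, fun x => ?_⟩
  obtain ⟨y, hy, hxy⟩ := hn (Set.mem_univ (π x))
  obtain ⟨g, hg⟩ := Quotient.exact' hxy
  refine ⟨g, g.2, ?_⟩
  have : (g : Isom E) x = y := hg
  rw [this]
  exact (mem_ball_zero_iff.1 hy).le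

theorem compact_of_exists_norm_le [FiniteDimensional ℝ E] (Γ : Subgroup (Isom E)) (d : ℝ)
    (h : ∀ x : E, ∃ g ∈ Γ, ‖g x‖ ≤ d) : CompactSpace (MulAction.orbitRel.Quotient Γ E) := by
  let π : E → MulAction.orbitRel.Quotient Γ E := Quotient.mk''
  have hπ : Continuous π := continuous_quotient_mk'
  refine ⟨?_⟩
  have : (Set.univ : Set (MulAction.orbitRel.Quotient Γ E)) = π '' Metric.closedBall 0 d := by
    symm
    rw [Set.eq_univ_iff_forall]
    intro p
    induction p using Quotient.inductionOn' with | _ x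
    obtain ⟨g, hg, hx⟩ := h x
    exact ⟨g x, by simpa using hx, Quotient.sound' ⟨⟨g, hg⟩, rfl⟩⟩
  rw [this]
  exact (isCompact_closedBall _ _).image hπ

end Isom

/-! ### Bieberbach's theorem: the translations span -/

section Crystallographic

variable {E : Type*} [NormedAddCommGroup E] [InnerProductSpace ℝ E]

open Isom

theorem Isom.norm_mul_inv_sub_one_le (g h : Isom E) :
    ‖lin (g * h⁻¹) - 1‖ ≤ ‖lin g - lin h‖ := by
  have : lin (g * h⁻¹) - 1 = (lin g - lin h) * lin h⁻¹ := by
    rw [sub_mul, ← lin_mul, ← lin_mul, mul_inv_cancel, lin_one]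
  rw [this]
  calc ‖(lin g - lin h) * lin h⁻¹‖ ≤ ‖lin g - lin h‖ * ‖lin h⁻¹‖ := norm_mul_le _ _
    _ ≤ ‖lin g - lin h‖ * 1 := by gcongr; exact norm_lin_le _
    _ = _ := mul_one _

/-- The commutator of `A` and `B` differs from `1` by no more than `AB - BA`, which is the additive
commutator of `A - 1` and `B - 1`. The estimate is quadratic, so linear parts near `1` have
commutators nearer still. -/
theorem Isom.norm_commutator_lin_sub_one_le (g h : Isom E) :
    ‖lin (g * h * g⁻¹ * h⁻¹) - 1‖ ≤ 2 * ‖lin g - 1‖ * ‖lin h - 1‖ := by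
  have h1 : g * h * g⁻¹ * h⁻¹ = (g * h) * (h * g)⁻¹ := by group
  rw [h1]
  refine (norm_mul_inv_sub_one_le _ _).trans ?_
  have h2 : lin (g * h) - lin (h * g) =
      (lin g - 1) * (lin h - 1) - (lin h - 1) * (lin g - 1) := by
    rw [lin_mul, lin_mul]; noncomm_ring
  rw [h2]
  calc _ ≤ ‖(lin g - 1) * (lin h - 1)‖ + ‖(lin h - 1) * (lin g - 1)‖ := norm_sub_le _ _
    _ ≤ ‖lin g - 1‖ * ‖lin h - 1‖ + ‖lin h - 1‖ * ‖lin g - 1‖ :=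
      add_le_add (norm_mul_le _ _) (norm_mul_le _ _)
    _ = _ := by ring

/-- Compactness of the unit sphere of `G`. The alternative `c = 0` covers `G = ⊥`, where that sphere
is empty. -/
theorem exists_norm_map_attained [FiniteDimensional ℝ E] (T : E →L[ℝ] E) (G : Submodule ℝ E) :
    ∃ c : ℝ, 0 ≤ c ∧ (∀ x ∈ G, ‖T x‖ ≤ c * ‖x‖) ∧
      (c = 0 ∨ ∃ x ∈ G, ‖x‖ = 1 ∧ ‖T x‖ = c) := by
  have hc : IsCompact (Metric.sphere (0 : E) 1 ∩ G) :=
    (isCompact_sphere _ _).inter_right G.closed_of_finiteDimensional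
  rcases (Metric.sphere (0 : E) 1 ∩ G).eq_empty_or_nonempty with h | h
  · refine ⟨0, le_rfl, fun x hx => ?_, Or.inl rfl⟩
    by_cases hx0 : x = 0
    · simp [hx0]
    · exfalso
      have : ‖x‖⁻¹ • x ∈ Metric.sphere (0 : E) 1 ∩ G :=
        ⟨by simp [norm_smul, hx0], G.smul_mem _ hx⟩
      rw [h] at this
      exact this
  · obtain ⟨x, ⟨hx1, hxG⟩, hmax⟩ := hc.exists_isMaxOn h
      (f := fun x => ‖T x‖) (by fun_prop)
    refine ⟨‖T x‖, norm_nonneg _, fun y hy => ?_, Or.inr ⟨x, hxG, by simpa using hx1, rfl⟩⟩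
    by_cases hy0 : y = 0
    · simp [hy0]
    · have hmem : ‖y‖⁻¹ • y ∈ Metric.sphere (0 : E) 1 ∩ G :=
        ⟨by simp [norm_smul, hy0], G.smul_mem _ hy⟩
      have h1 : ‖T (‖y‖⁻¹ • y)‖ ≤ ‖T x‖ := hmax hmem
      rw [map_smul, norm_smul, norm_inv, norm_norm, inv_mul_le_iff₀ (norm_pos_iff.2 hy0)] at h1
      linarith

theorem norm_le_of_add_orthogonal {F : Submodule ℝ E} {x y : E} (hx : x ∈ F) (hy : y ∈ Fᗮ) :
    ‖x‖ ≤ ‖x + y‖ ∧ ‖y‖ ≤ ‖x + y‖ := by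
  have h0 : inner ℝ x y = 0 := Submodule.inner_right_of_mem_orthogonal hx hy
  have h := norm_add_sq_eq_norm_sq_add_norm_sq_real h0
  constructor
  · refine le_of_sq_le_sq ?_ (norm_nonneg _)
    nlinarith [mul_self_nonneg ‖y‖]
  · refine le_of_sq_le_sq ?_ (norm_nonneg _)
    nlinarith [mul_self_nonneg ‖x‖]

variable [FiniteDimensional ℝ E]

/-- A group of isometries with cobounded orbits contains, for each direction, elements with
nearly trivial linear part which translate the origin nearly in this direction. -/
theorem exists_nearly_translation {Γ : Subgroup (Isom E)} {d : ℝ}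
    (hd : ∀ x : E, ∃ g ∈ Γ, ‖g x‖ ≤ d) (u : E) {ε δ : ℝ} (hε : 0 < ε) (hδ : 0 < δ) :
    ∃ g ∈ Γ, ∃ s > 0, ‖lin g - 1‖ ≤ ε ∧ ‖g 0 - s • u‖ ≤ δ * s := by
  have h1 : ∀ k : ℕ, ∃ g ∈ Γ, ‖g 0 - (k : ℝ) • u‖ ≤ d := by
    intro k
    obtain ⟨g, hg, h⟩ := hd ((k : ℝ) • u)
    refine ⟨g⁻¹, Γ.inv_mem hg, ?_⟩
    rw [← dist_eq_norm, ← g.dist_map, apply_inv_self, dist_zero_left]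
    exact h
  choose β hβ hβd using h1
  -- The linear parts are bounded, so along a subsequence they are eventually within `ε` of one
  -- fixed term. Dividing by that term changes the displacement by a constant only, which `δ * s`
  -- absorbs once `s = φ k` is large.
  obtain ⟨L, -, φ, hφ, hL⟩ := tendsto_subseq_of_bounded
    (Metric.isBounded_closedBall (x := (0 : E →L[ℝ] E)) (r := 1)) (x := fun k => lin (β k))
    (fun k => by simpa using norm_lin_le (β k))
  obtain ⟨N, hN⟩ := Metric.cauchySeq_iff'.1 hL.cauchySeq ε hε
  obtain ⟨K, hK⟩ := exists_nat_ge ((‖(β (φ N))⁻¹ 0‖ + d) / δ)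
  let k := max N (max K 1)
  have hk : (K : ℝ) ≤ φ k := by
    exact_mod_cast (le_max_left K 1).trans ((le_max_right _ _).trans (hφ.id_le k))
  have hk1 : 0 < φ k :=
    lt_of_lt_of_le one_pos ((le_max_right K 1).trans ((le_max_right _ _).trans (hφ.id_le k)))
  refine ⟨β (φ k) * (β (φ N))⁻¹, Γ.mul_mem (hβ _) (Γ.inv_mem (hβ _)), φ k,
    by exact_mod_cast hk1, (norm_mul_inv_sub_one_le _ _).trans ?_, ?_⟩
  · have := hN k (le_max_left _ _)
    rw [dist_eq_norm] at this
    exact this.le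
  · have h2 : ‖(β (φ k) * (β (φ N))⁻¹) 0 - β (φ k) 0‖ = ‖(β (φ N))⁻¹ 0‖ := by
      rw [mul_apply, apply_sub, norm_lin_apply, sub_zero]
    have h3 := norm_sub_le_norm_sub_add_norm_sub ((β (φ k) * (β (φ N))⁻¹) 0) (β (φ k) 0)
      ((φ k : ℝ) • u)
    have h4 : (‖(β (φ N))⁻¹ 0‖ + d) ≤ φ k * δ := (div_le_iff₀ hδ).1 (hK.trans hk)
    linarith [hβd (φ k)]

/-- The subspace on which the displacement of the linear part of `g` is maximal. -/
theorem exists_maximal_displacement_subspace (g : Isom E) (hg : lin g ≠ 1) :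
    ∃ (F : Submodule ℝ E) (c : ℝ), 0 ≤ c ∧ c < ‖lin g - 1‖ ∧ F ≠ ⊥ ∧
      (∀ x ∈ F, (lin g - 1) x ∈ F ∧ ‖(lin g - 1) x‖ = ‖lin g - 1‖ * ‖x‖) ∧
      (∀ x ∈ Fᗮ, (lin g - 1) x ∈ Fᗮ ∧ ‖(lin g - 1) x‖ ≤ c * ‖x‖) := by
  set T := lin g - 1 with hT
  set m := ‖T‖ with hm
  have hm0 : 0 < m := norm_pos_iff.2 (sub_ne_zero.2 hg)
  have hTx : ∀ x, T x = lin g x - x := fun x => rfl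
  -- `S` is the adjoint of `T` composed with `T`, since `lin g⁻¹` is the adjoint of `lin g`. Its
  -- eigenspace for `m ^ 2` is where `T` attains its norm.
  let S : E →L[ℝ] E := (2 : ℝ) • 1 - lin g - lin g⁻¹
  have hSx : ∀ x, S x = (2 : ℝ) • x - lin g x - lin g⁻¹ x := fun x => rfl
  have hadj : ∀ x y, inner ℝ (lin g x) y = inner ℝ x (lin g⁻¹ y) := fun x y => by
    conv_lhs => rw [← lin_apply_lin_inv g y, inner_lin_apply]
  let F : Submodule ℝ E := LinearMap.ker ((S - (m ^ 2) • 1 : E →L[ℝ] E) : E →ₗ[ℝ] E)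
  have hF : ∀ x, x ∈ F ↔ S x = m ^ 2 • x := fun x => by
    rw [LinearMap.mem_ker]
    exact sub_eq_zero
  have hSinner : ∀ x, inner ℝ (S x) x = ‖T x‖ ^ 2 := fun x => by
    rw [hSx, hTx, ← real_inner_self_eq_norm_sq]
    simp only [inner_sub_left, inner_sub_right, inner_smul_left, inner_lin_apply]
    have h1 : inner ℝ (lin g⁻¹ x) x = inner ℝ x (lin g x) := by
      rw [real_inner_comm, hadj x x |>.symm, real_inner_comm]
    rw [h1]
    simp only [conj_trivial]
    ring
  have hSnorm : ∀ x, ‖S x‖ ≤ m ^ 2 * ‖x‖ := fun x => by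
    have h1 : lin g (S x) = - T (T x) := by
      simp only [hSx, hTx, map_sub, map_smul, lin_apply_lin_inv]
      module
    rw [← norm_lin_apply g, h1, norm_neg]
    calc ‖T (T x)‖ ≤ m * ‖T x‖ := T.le_opNorm _
      _ ≤ m * (m * ‖x‖) := by gcongr; exact T.le_opNorm _
      _ = _ := by ring
  have hmemF : ∀ x, x ∈ F ↔ ‖T x‖ = m * ‖x‖ := fun x => by
    rw [hF]
    constructor
    · intro h
      have h1 := hSinner x
      rw [h, inner_smul_left, real_inner_self_eq_norm_sq, conj_trivial, ← mul_pow] at h1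
      exact ((pow_left_inj₀ (by positivity) (by positivity) two_ne_zero).1 h1).symm
    · intro h
      have h1 := hSinner x
      -- Equality case: expanding the square, `⟪S x, x⟫ = m ^ 2 * ‖x‖ ^ 2` and `‖S x‖ ≤ m ^ 2 * ‖x‖`
      -- leave nothing positive.
      have h2 : ‖S x - m ^ 2 • x‖ ^ 2 ≤ 0 := by
        rw [norm_sub_sq_real, inner_smul_right, h1, h, norm_smul,
          Real.norm_of_nonneg (by positivity)]
        have := pow_le_pow_left₀ (norm_nonneg _) (hSnorm x) 2
        nlinarith
      have h3 : ‖S x - m ^ 2 • x‖ = 0 := by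
        have := norm_nonneg (S x - m ^ 2 • x)
        nlinarith
      exact sub_eq_zero.1 (norm_eq_zero.1 h3)
  have hgF : ∀ x ∈ F, lin g x ∈ F := fun x hx => by
    rw [hF] at hx ⊢
    rw [← map_smul, ← hx]
    simp only [hSx, map_sub, map_smul, lin_apply_lin_inv, lin_inv_apply_lin]
  have hgF' : ∀ x ∈ F, lin g⁻¹ x ∈ F := fun x hx => by
    rw [hF] at hx ⊢
    rw [← map_smul, ← hx]
    simp only [hSx, map_sub, map_smul, lin_apply_lin_inv, lin_inv_apply_lin]
  have hFT : ∀ x ∈ F, T x ∈ F := fun x hx => F.sub_mem (hgF x hx) hx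
  have hFT' : ∀ x ∈ Fᗮ, T x ∈ Fᗮ := fun x hx => by
    refine Fᗮ.sub_mem ?_ hx
    rw [Submodule.mem_orthogonal'] at hx ⊢
    intro y hy
    exact (hadj x y).trans (hx _ (hgF' y hy))
  obtain ⟨c, hc0, hcle, hc⟩ := exists_norm_map_attained T Fᗮ
  refine ⟨F, c, hc0, ?_, ?_, fun x hx => ⟨hFT x hx, (hmemF x).1 hx⟩,
    fun x hx => ⟨hFT' x hx, hcle x hx⟩⟩
  · rcases hc with rfl | ⟨x, hx, hx1, hxc⟩
    · exact hm0
    · have hle : c ≤ m := by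
        have := T.le_opNorm x
        rwa [hxc, hx1, mul_one] at this
      -- The bound on `Fᗮ` is attained, so equality with `m` would put a unit vector of `Fᗮ` into
      -- `F`.
      refine lt_of_le_of_ne hle fun hcm => ?_
      have hxF : x ∈ F := (hmemF x).2 (by rw [hxc, hx1, hcm, mul_one])
      have : inner ℝ x x = 0 := Submodule.inner_right_of_mem_orthogonal hxF hx
      rw [inner_self_eq_zero] at this
      simp [this] at hx1
  · obtain ⟨c', hc'0, hc'le, hc'⟩ := exists_norm_map_attained T ⊤
    have h1 : m ≤ c' := T.opNorm_le_bound hc'0 fun x => hc'le x trivial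
    rcases hc' with rfl | ⟨x, -, hx1, hxc⟩
    · linarith
    · have h2 := T.le_opNorm x
      rw [hx1, mul_one, hxc] at h2
      have hxF : x ∈ F := (hmemF x).2 (by rw [hxc, hx1, mul_one]; exact le_antisymm h2 h1)
      intro hbot
      rw [hbot, Submodule.mem_bot] at hxF
      simp [hxF] at hx1

/-- Discreteness leaves finitely many elements below any given displacement, so minimal choices
exist. -/
theorem exists_minimal_displacement (Γ : Subgroup (Isom E)) [DiscreteTopology Γ]
    (P : Isom E → Prop) (h : ∃ g ∈ Γ, P g) :
    ∃ g ∈ Γ, P g ∧ ∀ k ∈ Γ, P k → ‖g 0‖ ≤ ‖k 0‖ := by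
  obtain ⟨g₀, hg₀, hP₀⟩ := h
  have hfin : {g | (g ∈ Γ ∧ ‖g 0‖ ≤ ‖g₀ 0‖) ∧ P g}.Finite :=
    (finite_of_discrete Γ ‖g₀ 0‖).subset fun g hg => hg.1
  obtain ⟨g, ⟨⟨hg, hle⟩, hP⟩, hmin⟩ := Set.exists_min_image _ (fun g : Isom E => ‖g 0‖) hfin
    ⟨g₀, ⟨hg₀, le_rfl⟩, hP₀⟩
  refine ⟨g, hg, hP, fun k hk hPk => ?_⟩
  by_cases hk' : ‖k 0‖ ≤ ‖g₀ 0‖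
  · exact hmin k ⟨⟨hk, hk'⟩, hPk⟩
  · exact hle.trans (not_le.1 hk').le

/-- An element of a crystallographic group whose linear part is close to the identity is a
translation. -/
theorem lin_eq_one_of_norm_le {Γ : Subgroup (Isom E)} [DiscreteTopology Γ] {d : ℝ}
    (hd : ∀ x : E, ∃ g ∈ Γ, ‖g x‖ ≤ d) {g : Isom E} (hg : g ∈ Γ) (hle : ‖lin g - 1‖ ≤ 1 / 2) :
    lin g = 1 := by
  by_contra hne
  obtain ⟨α, hα, ⟨hα1, hαm⟩, hαmin⟩ := exists_minimal_displacement Γ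
    (fun g => lin g ≠ 1 ∧ ‖lin g - 1‖ ≤ 1 / 2) ⟨g, hg, hne, hle⟩
  obtain ⟨F, c, hc0, hcm, hFbot, hF, hF'⟩ := exists_maximal_displacement_subspace α hα1
  set T := lin α - 1 with hT
  set m := ‖T‖ with hm
  -- Among nearly pure translations whose displacement leans towards `F`, take a shortest. They
  -- exist: a nearly translation along a unit vector of `F` with relative error `1 / 4` has `F`-part
  -- at least `3 / 4 * s` and orthogonal part at most `s / 4`.
  obtain ⟨β, hβ, ⟨hβm, x, hx, y, hy, hβ0, hyx⟩, hβmin⟩ := exists_minimal_displacement Γ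
    (fun g => ‖lin g - 1‖ ≤ (m - c) / 8 ∧ ∃ x ∈ F, ∃ y ∈ Fᗮ, g 0 = x + y ∧ ‖y‖ < ‖x‖) (by
      obtain ⟨u, huF, hu0⟩ := F.exists_mem_ne_zero_of_ne_bot hFbot
      obtain ⟨g, hg, s, hs, h1, h2⟩ := exists_nearly_translation hd (‖u‖⁻¹ • u)
        (ε := (m - c) / 8) (δ := 1 / 4) (by linarith) (by norm_num)
      refine ⟨g, hg, h1, ?_⟩
      obtain ⟨e₁, he₁, e₂, he₂, he⟩ :=
        F.exists_add_mem_mem_orthogonal (g 0 - s • ‖u‖⁻¹ • u)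
      refine ⟨s • ‖u‖⁻¹ • u + e₁, F.add_mem (F.smul_mem _ (F.smul_mem _ huF)) he₁, e₂, he₂, ?_, ?_⟩
      · rw [add_assoc, ← he]; abel
      · rw [he] at h2
        obtain ⟨h3, h4⟩ := norm_le_of_add_orthogonal he₁ he₂
        have h5 : ‖s • ‖u‖⁻¹ • u‖ = s := by
          rw [norm_smul, norm_smul, norm_inv, norm_norm, inv_mul_cancel₀ (norm_ne_zero_iff.2 hu0),
            mul_one, Real.norm_of_nonneg hs.le]
        have h6 := norm_le_add_norm_add (s • ‖u‖⁻¹ • u) e₁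
        linarith)
  have hb0 : 0 < ‖β 0‖ := by
    have := (norm_le_of_add_orthogonal hx hy).1
    rw [← hβ0] at this
    linarith [norm_nonneg y]
  -- Either `β` is a translation and both sides vanish, or `β` competes with `α` in its minimality.
  have hba : ‖lin β - 1‖ * ‖α 0‖ ≤ ‖lin β - 1‖ * ‖β 0‖ := by
    by_cases hβ1 : lin β = 1
    · simp [hβ1]
    · exact mul_le_mul_of_nonneg_left (hαmin β hβ ⟨hβ1, by linarith⟩) (norm_nonneg _)
  -- The commutator satisfies the conditions defining `β` but is shorter. Its linear part is no
  -- farther from `1` because `2 * (1 / 2) = 1` in the commutator estimate. Up to the small error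
  -- `r` it moves the origin by `T (β 0)`, and `T` stretches the `F`-part by `m` and the orthogonal
  -- part by at most `c < m`, so the lean towards `F` survives. Its length is at most `(m + (m - c)
  -- / 4) * ‖β 0‖`, where `m ≤ 1 / 2`.
  set κ := α * β * α⁻¹ * β⁻¹ with hκ
  have hκΓ : κ ∈ Γ := Γ.mul_mem (Γ.mul_mem (Γ.mul_mem hα hβ) (Γ.inv_mem hα)) (Γ.inv_mem hβ)
  have hκm : ‖lin κ - 1‖ ≤ ‖lin β - 1‖ := by
    refine (norm_commutator_lin_sub_one_le α β).trans ?_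
    nlinarith [norm_nonneg (lin β - 1)]
  obtain ⟨r, hr⟩ : ∃ r, κ 0 = T (β 0) + r := ⟨κ 0 - T (β 0), by abel⟩
  have hreq : r = - (lin κ - 1) (β 0) - lin α ((lin β - 1) (lin α⁻¹ (α 0))) := by
    have h1 : κ (β (α 0)) = α (β 0) := by simp [hκ]
    have h2 : lin κ (lin β (α 0)) = lin α (lin β (lin α⁻¹ (α 0))) := by
      have : lin κ * lin β = lin α * lin β * lin α⁻¹ := by
        rw [← lin_mul, ← lin_mul, ← lin_mul, hκ, inv_mul_cancel_right]
      exact congrArg (fun L : E →L[ℝ] E => L (α 0)) this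
    rw [apply_eq_lin κ, apply_eq_lin β (α 0), map_add, h2, hr, apply_eq_lin α (β 0)] at h1
    have h3 : r = lin α (β 0) + α 0 - lin α (lin β (lin α⁻¹ (α 0))) - lin κ (β 0) - T (β 0) := by
      rw [← h1]; abel
    rw [h3, hT]
    have h4 : lin α ((lin β - 1) (lin α⁻¹ (α 0))) =
        lin α (lin β (lin α⁻¹ (α 0))) - α 0 := by
      change lin α (lin β _ - _) = _
      rw [map_sub]
      congr 1
      exact lin_apply_lin_inv α (α 0)
    rw [h4]
    change _ - (lin α (β 0) - β 0) = -(lin κ (β 0) - β 0) - _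
    abel
  have hrle : ‖r‖ ≤ (m - c) / 4 * ‖β 0‖ := by
    have h1 : ‖(lin κ - 1) (β 0)‖ ≤ ‖lin β - 1‖ * ‖β 0‖ :=
      ((lin κ - 1).le_opNorm _).trans (by gcongr)
    have h2 : ‖lin α ((lin β - 1) (lin α⁻¹ (α 0)))‖ ≤ ‖lin β - 1‖ * ‖α 0‖ := by
      rw [norm_lin_apply]
      refine ((lin β - 1).le_opNorm _).trans ?_
      rw [norm_lin_apply]
    have h3 : ‖r‖ ≤ ‖(lin κ - 1) (β 0)‖ + ‖lin α ((lin β - 1) (lin α⁻¹ (α 0)))‖ := by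
      rw [hreq]
      refine (norm_sub_le _ _).trans ?_
      rw [norm_neg]
    nlinarith
  obtain ⟨r₁, hr₁, r₂, hr₂, hrr⟩ := F.exists_add_mem_mem_orthogonal r
  obtain ⟨hr₁le, hr₂le⟩ := norm_le_of_add_orthogonal hr₁ hr₂
  rw [← hrr] at hr₁le hr₂le
  have hbxy : ‖β 0‖ ≤ ‖x‖ + ‖y‖ := by rw [hβ0]; exact norm_add_le _ _
  have hfin := hβmin κ hκΓ ⟨hκm.trans hβm, T x + r₁, F.add_mem (hF x hx).1 hr₁, T y + r₂,
    Fᗮ.add_mem (hF' y hy).1 hr₂, by rw [hr, hβ0, map_add, hrr]; abel, by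
      have h1 : ‖T y + r₂‖ ≤ c * ‖y‖ + ‖r‖ := (norm_add_le _ _).trans
        (add_le_add (hF' y hy).2 hr₂le)
      have h2 : m * ‖x‖ ≤ ‖T x + r₁‖ + ‖r‖ := by
        rw [← (hF x hx).2]
        exact (norm_le_add_norm_add _ _).trans (by gcongr)
      have h3 : c * ‖y‖ ≤ c * ‖x‖ := by gcongr
      have h4 : (m - c) / 4 * ‖β 0‖ ≤ (m - c) / 4 * (‖x‖ + ‖y‖) := by
        gcongr
      nlinarith⟩
  have h1 : ‖κ 0‖ ≤ m * ‖β 0‖ + ‖r‖ := by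
    rw [hr]
    exact (norm_add_le _ _).trans (add_le_add (T.le_opNorm _) le_rfl)
  nlinarith

/-- The translations in a crystallographic group span the space. -/
theorem IsSpaceGroup.spanOf_eq_top {n : ℕ} {Γ : Subgroup (Isom E)} (hΓ : IsSpaceGroup n Γ) :
    spanOf Γ = ⊤ := by
  have := hΓ.discrete
  have := hΓ.compact
  obtain ⟨d, hd⟩ := exists_norm_le_of_compact Γ
  rw [← Submodule.orthogonal_eq_bot_iff]
  by_contra hbot
  obtain ⟨u, hu, hu0⟩ := Submodule.exists_mem_ne_zero_of_ne_bot hbot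
  have hu0' : 0 < ‖u‖ := norm_pos_iff.2 hu0
  obtain ⟨g, hg, s, hs, h1, h2⟩ := exists_nearly_translation hd u
    (ε := 1 / 2) (δ := ‖u‖ / 2) (by norm_num) (by positivity)
  have hlin := lin_eq_one_of_norm_le hd hg h1
  have hmem : g 0 ∈ spanOf Γ := by
    refine Submodule.subset_span ?_
    have : AffineIsometryEquiv.constVAdd ℝ E (g 0) = g := by
      ext x
      rw [apply_eq_lin g x, hlin]
      exact add_comm _ _
    rw [Set.mem_ofPred_eq, this]
    exact hg
  -- `g 0` lies in the span and `s • u` is orthogonal to it, so `g 0` is at distance at least `s *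
  -- ‖u‖` from `s • u`, while `δ` was chosen to allow only half of that.
  have h3 : ‖-(s • u)‖ ≤ ‖g 0 + -(s • u)‖ :=
    (norm_le_of_add_orthogonal hmem (Submodule.neg_mem _ (Submodule.smul_mem _ s hu))).2
  rw [norm_neg, norm_smul, Real.norm_of_nonneg hs.le, ← sub_eq_add_neg] at h3
  nlinarith [mul_pos hs hu0']

end Crystallographic

/-! ### Genericity for affine subspaces, local isometries, reflections -/

section AffineGenericity

variable {E : Type*} [NormedAddCommGroup E] [InnerProductSpace ℝ E]

open Isom

theorem AffineSubspace.eq_top_of_isOpen_subset {S : AffineSubspace ℝ E} {U : Set E}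
    (hU : IsOpen U) (hne : U.Nonempty) (h : U ⊆ S) : S = ⊤ := by
  rw [eq_top_iff, ← hU.affineSpan_eq_top hne]
  exact affineSpan_le.2 h

/-- Countably many proper affine subspaces do not cover any open set. -/
theorem dense_forall_notMem_affineSubspace [FiniteDimensional ℝ E] {ι : Type*} [Countable ι]
    (S : ι → AffineSubspace ℝ E) (hS : ∀ i, S i ≠ ⊤) : Dense {x | ∀ i, x ∉ S i} := by
  have : {x | ∀ i, x ∉ S i} = ⋂ i, ((S i : Set E))ᶜ := by
    ext x; simp
  rw [this]
  refine dense_iInter_of_isOpen (fun i => (S i).closed_of_finiteDimensional.isOpen_compl)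
    fun i => ?_
  rw [← interior_eq_empty_iff_dense_compl]
  by_contra hne
  exact hS i (AffineSubspace.eq_top_of_isOpen_subset isOpen_interior
    (Set.nonempty_iff_ne_empty.2 hne) interior_subset)

/-- The affine subspace on which two isometries agree. -/
def Isom.eqLocus (g h : Isom E) : AffineSubspace ℝ E where
  carrier := {x | g x = h x}
  smul_vsub_vadd_mem' c x y z hx hy hz := by
    have key : ∀ k : Isom E, k (c • (x -ᵥ y) +ᵥ z) = c • (k x - k y) + k z := fun k => by
      rw [AffineIsometryEquiv.map_vadd, map_smul, AffineIsometryEquiv.map_vsub]; rfl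
    change g _ = h _
    rw [key, key, show g x = h x from hx, show g y = h y from hy, show g z = h z from hz]

theorem Isom.mem_eqLocus {g h : Isom E} {x : E} : x ∈ eqLocus g h ↔ g x = h x := Iff.rfl

theorem Isom.eq_of_eqLocus_eq_top {g h : Isom E} (H : eqLocus g h = ⊤) : g = h :=
  AffineIsometryEquiv.ext fun x => mem_eqLocus.1 (H ▸ AffineSubspace.mem_top ℝ E x)

theorem Isom.eq_of_eqOn_isOpen {g h : Isom E} {U : Set E} (hU : IsOpen U) (hne : U.Nonempty)
    (H : ∀ x ∈ U, g x = h x) : g = h :=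
  eq_of_eqLocus_eq_top (AffineSubspace.eq_top_of_isOpen_subset hU hne H)

/-- A point is determined by its distances to the points of an open set. -/
theorem eq_of_dist_eq_on_isOpen {a b : E} {U : Set E} (hU : IsOpen U) (hne : U.Nonempty)
    (H : ∀ x ∈ U, dist a x = dist b x) : a = b :=
  AffineSubspace.perpBisector_eq_top.1 (AffineSubspace.eq_top_of_isOpen_subset hU hne
    fun x hx => AffineSubspace.mem_perpBisector_iff_dist_eq.2
      (by rw [dist_comm x, dist_comm x]; exact H x hx))

/-- A distance-preserving map on a ball extends to an isometry of the space. -/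
theorem exists_isom_eqOn_ball [FiniteDimensional ℝ E] (σ : E → E) (x : E) {r : ℝ} (hr : 0 < r)
    (hσ : ∀ y ∈ Metric.ball x r, ∀ z ∈ Metric.ball x r, dist (σ y) (σ z) = dist y z) :
    ∃ α : Isom E, ∀ y ∈ Metric.ball x r, α y = σ y := by
  let τ : E → E := fun v => σ (x + v) - σ x
  have hmem : ∀ v : E, ‖v‖ < r → x + v ∈ Metric.ball x r := fun v hv => by simpa using hv
  have hx : x ∈ Metric.ball x r := Metric.mem_ball_self hr
  have hτd : ∀ v w : E, ‖v‖ < r → ‖w‖ < r → ‖τ v - τ w‖ = ‖v - w‖ := fun v w hv hw => by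
    have := hσ _ (hmem v hv) _ (hmem w hw)
    rw [dist_add_left, dist_eq_norm, dist_eq_norm] at this
    simpa [τ] using this
  have hτn : ∀ v : E, ‖v‖ < r → ‖τ v‖ = ‖v‖ := fun v hv => by
    have := hτd v 0 hv (by simpa using hr)
    simpa [τ] using this
  have hτi : ∀ v w : E, ‖v‖ < r → ‖w‖ < r → inner ℝ (τ v) (τ w) = inner ℝ v w :=
    fun v w hv hw => by
      rw [real_inner_eq_norm_mul_self_add_norm_mul_self_sub_norm_sub_mul_self_div_two,
        real_inner_eq_norm_mul_self_add_norm_mul_self_sub_norm_sub_mul_self_div_two,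
        hτn v hv, hτn w hw, hτd v w hv hw]
  let b := stdOrthonormalBasis ℝ E
  -- `τ` is controlled only on the ball of radius `r`, so the basis vectors are shrunk into it
  -- before `τ` is applied and rescaled afterwards.
  let e : Fin (Module.finrank ℝ E) → E := fun i => (2 / r) • τ ((r / 2) • b i)
  have hsmall : ∀ i, ‖(r / 2) • b i‖ < r := fun i => by
    rw [norm_smul, b.norm_eq_one, mul_one, Real.norm_of_nonneg (by positivity)]
    linarith
  have he : Orthonormal ℝ e := by
    rw [orthonormal_iff_ite]
    intro i j
    simp only [e, inner_smul_left, inner_smul_right, hτi _ _ (hsmall i) (hsmall j), conj_trivial]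
    rw [orthonormal_iff_ite.1 b.orthonormal i j]
    split_ifs
    · field_simp
    · simp
  let e' : OrthonormalBasis (Fin (Module.finrank ℝ E)) ℝ E := OrthonormalBasis.mk he (by
    exact (he.linearIndependent.span_eq_top_of_card_eq_finrank' (by simp)).ge)
  have he' : ∀ i, e' i = e i := fun i => by simp [e']
  let L : E ≃ₗᵢ[ℝ] E := b.equiv e' (Equiv.refl _)
  have hL : ∀ v : E, ‖v‖ < r → L v = τ v := fun v hv => by
    refine InnerProductSpace.ext_inner_right_basis e'.toBasis fun i => ?_
    rw [OrthonormalBasis.coe_toBasis]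
    have h1 : L (b i) = e' i := by simp [L]
    rw [← h1, L.inner_map_map, h1, he']
    simp only [e, inner_smul_right, hτi v _ hv (hsmall i)]
    field_simp
  refine ⟨AffineIsometryEquiv.mk' (fun y => L (y - x) + σ x) L x (fun y => by simp), fun y hy => ?_⟩
  have h1 := hL (y - x) (by rwa [← dist_eq_norm])
  change L (y - x) + σ x = σ y
  rw [h1]
  simp [τ]

/-- An isometry fixing a hyperplane pointwise is the identity or the reflection in it. -/
theorem Isom.eq_one_or_reflection {g : Isom E} {p n : E} (hn : ‖n‖ = 1) (hp : g p = p)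
    (h : ∀ v, inner ℝ n v = 0 → lin g v = v) :
    g = 1 ∨ ∀ y, g y = y - (2 * inner ℝ n (y - p)) • n := by
  set c : ℝ := inner ℝ n (lin g n) with hc
  have hnn : inner ℝ n n = (1 : ℝ) := by rw [real_inner_self_eq_norm_sq, hn, one_pow]
  have hw0 : inner ℝ n (lin g n - c • n) = 0 := by
    rw [inner_sub_right, inner_smul_right, hnn, ← hc]; ring
  -- The component of `lin g n` in the hyperplane is fixed by `lin g`, hence orthogonal to `lin g n`
  -- because it is orthogonal to `n`; so it vanishes.
  have hw : lin g n = c • n := by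
    rw [← sub_eq_zero, ← inner_self_eq_zero (𝕜 := ℝ)]
    have h1 : inner ℝ (lin g n - c • n) (lin g n) = 0 := by
      conv_lhs => rw [← h _ hw0, inner_lin_apply, real_inner_comm, hw0]
    conv_lhs => rw [inner_sub_right, h1, inner_smul_right, real_inner_comm, hw0]
    ring
  have hc2 : c = 1 ∨ c = -1 := by
    have h1 := norm_lin_apply g n
    rw [hw, norm_smul, hn, mul_one, Real.norm_eq_abs] at h1
    exact eq_or_eq_neg_of_abs_eq h1
  have hg : ∀ y, g y = y + ((c - 1) * inner ℝ n (y - p)) • n := fun y => by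
    have h1 : g y = lin g (y - p) + p := by rw [← apply_sub, hp]; abel
    have h2 : y - p = (y - p - (inner ℝ n (y - p) : ℝ) • n) + (inner ℝ n (y - p) : ℝ) • n := by
      abel
    rw [h1]
    conv_lhs => rw [h2]
    rw [map_add, map_smul, hw, h (y - p - (inner ℝ n (y - p) : ℝ) • n)
      (by rw [inner_sub_right, inner_smul_right, hnn]; ring)]
    module
  rcases hc2 with h1 | h1
  · left
    exact AffineIsometryEquiv.ext fun y => by rw [hg, h1]; simp
  · right
    intro y
    rw [hg, h1]
    module

/-- A proper subspace which becomes everything on adding one vector has a unit normal vector. -/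
theorem exists_unit_normal [FiniteDimensional ℝ E] {D : Submodule ℝ E} {u : E} (hD : D ≠ ⊤)
    (hu : D ⊔ Submodule.span ℝ {u} = ⊤) : ∃ n : E, ‖n‖ = 1 ∧ ∀ v, inner ℝ n v = 0 → v ∈ D := by
  have h1 : Dᗮ ≠ ⊥ := fun h => hD (Submodule.orthogonal_eq_bot_iff.1 h)
  obtain ⟨n, hn, hn0⟩ := Submodule.exists_mem_ne_zero_of_ne_bot h1
  have key : ∀ v, inner ℝ n v = 0 → v ∈ D := by
    have hdec : ∀ v : E, ∃ d ∈ D, ∃ c : ℝ, d + c • u = v := fun v => by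
      have hv : v ∈ D ⊔ Submodule.span ℝ {u} := hu ▸ Submodule.mem_top
      obtain ⟨d, hd, w, hw, rfl⟩ := Submodule.mem_sup.1 hv
      obtain ⟨c, rfl⟩ := Submodule.mem_span_singleton.1 hw
      exact ⟨d, hd, c, rfl⟩
    have hnd : ∀ d ∈ D, inner ℝ n d = 0 := fun d hd => Submodule.inner_left_of_mem_orthogonal hd hn
    intro v hv
    obtain ⟨d, hd, c, rfl⟩ := hdec v
    rw [inner_add_right, hnd d hd, zero_add, inner_smul_right, mul_eq_zero] at hv
    rcases hv with rfl | hv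
    · simpa using hd
    · exfalso
      obtain ⟨d', hd', c', h'⟩ := hdec n
      have : inner ℝ n n = 0 := by
        have h2 : inner ℝ n (d' + c' • u) = 0 := by
          rw [inner_add_right, hnd d' hd', inner_smul_right, hv]; simp
        rwa [h'] at h2
      exact hn0 (inner_self_eq_zero.1 this)
  refine ⟨‖n‖⁻¹ • n, by simp [norm_smul, hn0], fun v hv => key v ?_⟩
  rw [inner_smul_left, mul_eq_zero] at hv
  rcases hv with hv | hv
  · simp [hn0] at hv
  · exact hv

end AffineGenericity

/-! ### Geometry of the orbit space and its free points -/

section Lifting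

variable {E : Type*} [NormedAddCommGroup E] [InnerProductSpace ℝ E]

open Isom

theorem OrbitSpace.mk_smul {Γ : Subgroup (Isom E)} {g : Isom E} (hg : g ∈ Γ) (x : E) :
    OrbitSpace.mk Γ (g x) = OrbitSpace.mk Γ x := OrbitSpace.mk_eq_mk.2 ⟨⟨g, hg⟩, rfl⟩

theorem OrbitSpace.dist_mk_le (Γ : Subgroup (Isom E)) (x y : E) :
    dist (OrbitSpace.mk Γ x) (OrbitSpace.mk Γ y) ≤ dist x y := orbitDist_le Γ x y 1

theorem OrbitSpace.dist_mk_le' {Γ : Subgroup (Isom E)} {g : Isom E} (hg : g ∈ Γ) (x y : E) :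
    dist (OrbitSpace.mk Γ x) (OrbitSpace.mk Γ y) ≤ dist x (g y) := orbitDist_le Γ x y ⟨g, hg⟩

theorem OrbitSpace.continuous_mk (Γ : Subgroup (Isom E)) : Continuous (OrbitSpace.mk Γ) :=
  (LipschitzWith.of_dist_le' (K := 1) fun x y => by
    rw [one_mul]; exact OrbitSpace.dist_mk_le Γ x y).continuous

/-- The stabilizer of `x` in `Γ` is trivial. -/
def IsFreePoint (Γ : Subgroup (Isom E)) (x : E) : Prop := ∀ g ∈ Γ, g x = x → g = 1

/-- The set on which `α` lifts the map `f` of the orbit space. -/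
def liftLocus {Γ : Subgroup (Isom E)} (f : OrbitSpace Γ ≃ᵢ OrbitSpace Γ) (α : Isom E) : Set E :=
  {y | f (OrbitSpace.mk Γ y) = OrbitSpace.mk Γ (α y)}

theorem mem_liftLocus {Γ : Subgroup (Isom E)} {f : OrbitSpace Γ ≃ᵢ OrbitSpace Γ}
    {α : Isom E} {y : E} :
    y ∈ liftLocus f α ↔ f (OrbitSpace.mk Γ y) = OrbitSpace.mk Γ (α y) := Iff.rfl

variable [FiniteDimensional ℝ E] {Γ : Subgroup (Isom E)} [DiscreteTopology Γ]

-- Only finitely many points of an orbit compete for the infimum, so it is attained.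
variable (Γ) in
theorem OrbitSpace.exists_dist_eq (x y : E) :
    ∃ g ∈ Γ, dist (OrbitSpace.mk Γ x) (OrbitSpace.mk Γ y) = dist x (g y) := by
  obtain ⟨g, ⟨hg, hle⟩, hmin⟩ := Set.exists_min_image _ (fun g : Isom E => dist x (g y))
    (finite_of_discrete_dist Γ y x (dist y x)) ⟨1, Γ.one_mem, le_rfl⟩
  refine ⟨g, hg, le_antisymm (OrbitSpace.dist_mk_le' hg x y) ?_⟩
  rw [OrbitSpace.dist_mk]
  refine le_ciInf fun k => ?_
  by_cases hk : dist ((k : Isom E) y) x ≤ dist y x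
  · exact hmin k ⟨k.2, hk⟩
  · rw [dist_comm x, dist_comm x]
    exact hle.trans (not_le.1 hk).le

theorem OrbitSpace.eq_of_dist_eq_zero {p q : OrbitSpace Γ} (h : dist p q = 0) : p = q := by
  obtain ⟨x, rfl⟩ := OrbitSpace.mk_surjective Γ p
  obtain ⟨y, rfl⟩ := OrbitSpace.mk_surjective Γ q
  obtain ⟨g, hg, hd⟩ := OrbitSpace.exists_dist_eq Γ x y
  rw [h] at hd
  rw [dist_eq_zero.1 hd.symm, OrbitSpace.mk_smul hg]

/-- Each orbit has a representative realizing its distance to a given orbit. -/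
theorem OrbitSpace.exists_rep (x : E) (p : OrbitSpace Γ) :
    ∃ z, OrbitSpace.mk Γ z = p ∧ dist z x = dist p (OrbitSpace.mk Γ x) := by
  obtain ⟨y, rfl⟩ := OrbitSpace.mk_surjective Γ p
  obtain ⟨g, hg, hd⟩ := OrbitSpace.exists_dist_eq Γ x y
  exact ⟨g y, OrbitSpace.mk_smul hg y, by rw [dist_comm, ← hd, dist_comm]⟩

-- Only finitely many elements move `x` by at most `1`, so the nonzero displacements of `x` are
-- bounded away from `0`.
variable (Γ) in
theorem exists_orbit_gap (x : E) :
    ∃ r > 0, ∀ g ∈ Γ, g x ≠ x → r < dist (g x) x := by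
  have hfin : {g | (g ∈ Γ ∧ dist (g x) x ≤ 1) ∧ g x ≠ x}.Finite :=
    (finite_of_discrete_dist Γ x x 1).subset fun g hg => hg.1
  have h1 : ∀ᶠ r : ℝ in 𝓝[>] 0, ∀ g ∈ {g | (g ∈ Γ ∧ dist (g x) x ≤ 1) ∧ g x ≠ x},
      r < dist (g x) x := by
    refine (Filter.eventually_all_finite hfin).2 fun g hg => ?_
    exact nhdsWithin_le_nhds (Iio_mem_nhds (dist_pos.2 hg.2))
  have h2 : ∀ᶠ r : ℝ in 𝓝[>] 0, r < 1 := nhdsWithin_le_nhds (Iio_mem_nhds one_pos)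
  obtain ⟨r, ⟨hr1, hr2⟩, hr0⟩ := ((h1.and h2).and self_mem_nhdsWithin).exists
  refine ⟨r, hr0, fun g hg hgx => ?_⟩
  by_cases h : dist (g x) x ≤ 1
  · exact hr1 g ⟨⟨hg, h⟩, hgx⟩
  · exact hr2.trans (not_le.1 h)

/-- The orbit map is isometric near a point with trivial stabilizer. -/
theorem IsFreePoint.exists_isometric_ball {x : E} (hx : IsFreePoint Γ x) :
    ∃ r > 0, ∀ y ∈ Metric.ball x r, ∀ z ∈ Metric.ball x r,
      dist (OrbitSpace.mk Γ y) (OrbitSpace.mk Γ z) = dist y z := by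
  obtain ⟨r, hr, hgap⟩ := exists_orbit_gap Γ x
  refine ⟨r / 4, by positivity, fun y hy z hz => le_antisymm (OrbitSpace.dist_mk_le Γ y z) ?_⟩
  rw [Metric.mem_ball] at hy hz
  obtain ⟨g, hg, hd⟩ := OrbitSpace.exists_dist_eq Γ y z
  rw [hd]
  by_cases hg1 : g = 1
  · rw [hg1]; exact le_rfl
  · have h1 := hgap g hg fun h => hg1 (hx g hg h)
    have h2 : dist (g x) (g z) = dist z x := by rw [g.dist_map, dist_comm]
    have h3 := dist_triangle4 (g x) (g z) y x
    have h4 := dist_triangle_right y z x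
    rw [dist_comm (g z) y] at h3
    linarith

/-- A metric characterization of the orbits with trivial stabilizer: in a small ball, every
point has an antipode. -/
theorem isFreePoint_iff {x : E} : IsFreePoint Γ x ↔
    ∃ r > 0, ∀ p : OrbitSpace Γ, dist p (OrbitSpace.mk Γ x) < r →
      ∃ q, dist q (OrbitSpace.mk Γ x) = dist p (OrbitSpace.mk Γ x) ∧
        dist p q = 2 * dist p (OrbitSpace.mk Γ x) := by
  constructor
  · intro hx
    obtain ⟨r, hr, hiso⟩ := hx.exists_isometric_ball
    refine ⟨r, hr, fun p hp => ?_⟩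
    obtain ⟨y, rfl, hy⟩ := OrbitSpace.exists_rep x p
    rw [← hy] at hp ⊢
    have h1 : dist (AffineIsometryEquiv.pointReflection ℝ x y) x = dist y x :=
      AffineIsometryEquiv.dist_pointReflection_fixed ..
    have hy' : AffineIsometryEquiv.pointReflection ℝ x y ∈ Metric.ball x r := by
      rw [Metric.mem_ball, h1]; exact hp
    refine ⟨OrbitSpace.mk Γ (AffineIsometryEquiv.pointReflection ℝ x y), ?_, ?_⟩
    · rw [hiso _ hy' _ (Metric.mem_ball_self hr), h1]
    · rw [hiso _ hp _ hy', dist_comm, AffineIsometryEquiv.dist_pointReflection_self_real,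
        dist_comm x]
  · rintro ⟨r, hr, H⟩ g hg hgx
    obtain ⟨δ, hδ, hgap⟩ := exists_orbit_gap Γ x
    have hdist : ∀ y, dist y x < δ / 2 → dist (OrbitSpace.mk Γ y) (OrbitSpace.mk Γ x) = dist y x :=
      fun y hy => by
        refine le_antisymm (OrbitSpace.dist_mk_le Γ y x) ?_
        obtain ⟨k, hk, hd⟩ := OrbitSpace.exists_dist_eq Γ y x
        rw [hd]
        by_cases hkx : k x = x
        · rw [hkx]
        · have h1 := hgap k hk hkx
          have h2 := dist_triangle_left (k x) x y
          linarith
    refine eq_of_eqOn_isOpen (Metric.isOpen_ball (x := x) (ε := min r (δ / 2)))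
      ⟨x, Metric.mem_ball_self (lt_min hr (by positivity))⟩ fun w hw => ?_
    set y := AffineIsometryEquiv.pointReflection ℝ x w with hy
    have hyx : dist y x = dist w x := AffineIsometryEquiv.dist_pointReflection_fixed ..
    obtain ⟨hw1, hw2⟩ := lt_min_iff.1 (Metric.mem_ball.1 hw)
    have hyd := hdist y (by rw [hyx]; exact hw2)
    obtain ⟨q, hq1, hq2⟩ := H (OrbitSpace.mk Γ y) (by rw [hyd, hyx]; exact hw1)
    obtain ⟨z, rfl, hz⟩ := OrbitSpace.exists_rep x q
    rw [hq1, hyd] at hz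
    rw [hyd] at hq2
    -- An orbit antipodal to that of `y` has a representative `z` all of whose images under the
    -- stabilizer of `x` are at the maximal distance from `y`, so all equal its reflection `w`.
    -- Applied to `1` and to `g`, this makes `g` fix every `w` near `x`.
    have key : ∀ k ∈ Γ, k x = x → k z = w := fun k hk hkx => by
      have h1 : dist (k z) x = dist y x := by
        conv_lhs => rw [← hkx, k.dist_map]
        exact hz
      have h2 : 2 * dist y x ≤ dist y (k z) := by
        rw [← hq2]
        exact OrbitSpace.dist_mk_le' hk y z
      have h3 : dist y (k z) = 2 * dist y x :=
        le_antisymm (by linarith [dist_triangle_right y (k z) x]) h2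
      have h4 : x = midpoint ℝ y (k z) := eq_midpoint_of_dist_eq_half (by linarith)
        (by rw [dist_comm, h1]; linarith)
      have h5 := AffineIsometryEquiv.pointReflection_midpoint_left y (k z)
      rw [← h4] at h5
      rw [← h5, hy, AffineIsometryEquiv.pointReflection_involutive]
    have h1 : z = w := key 1 Γ.one_mem rfl
    have h2 := key g hg hgx
    rw [h1] at h2
    exact h2

/-- The antipode criterion speaks only of distances in the orbit space, so `f` transports it. -/
theorem isFreePoint_of_map_eq (f : OrbitSpace Γ ≃ᵢ OrbitSpace Γ) {x y : E}
    (h : f (OrbitSpace.mk Γ x) = OrbitSpace.mk Γ y) (hx : IsFreePoint Γ x) :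
    IsFreePoint Γ y := by
  rw [isFreePoint_iff] at hx ⊢
  obtain ⟨r, hr, H⟩ := hx
  refine ⟨r, hr, fun p hp => ?_⟩
  obtain ⟨p, rfl⟩ := f.surjective p
  rw [← h, f.dist_eq] at hp ⊢
  obtain ⟨q, hq1, hq2⟩ := H p hp
  exact ⟨f q, by rw [f.dist_eq, hq1], by rw [f.dist_eq, hq2]⟩

theorem isFreePoint_iff_of_map_eq (f : OrbitSpace Γ ≃ᵢ OrbitSpace Γ) {x y : E}
    (h : f (OrbitSpace.mk Γ x) = OrbitSpace.mk Γ y) : IsFreePoint Γ x ↔ IsFreePoint Γ y :=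
  ⟨isFreePoint_of_map_eq f h, isFreePoint_of_map_eq f.symm (f.symm_apply_eq.2 h.symm)⟩

variable (Γ) in
theorem dense_isFreePoint : Dense {x | IsFreePoint Γ x} := by
  have := countable_of_discrete Γ
  have h := dense_forall_notMem_affineSubspace
    (fun g : {g : Γ // g ≠ 1} => eqLocus (g.1 : Isom E) 1)
    fun g h => g.2 (Subtype.ext (eq_of_eqLocus_eq_top h))
  refine h.mono fun x hx g hg hgx => ?_
  by_contra hg1
  exact hx ⟨⟨g, hg⟩, fun h => hg1 (congrArg Subtype.val h)⟩ hgx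

/-- Isometries inducing the same map to the orbit space differ by an element of the group. -/
theorem exists_eq_mul_of_mk_eq {α β : Isom E}
    (h : ∀ x, OrbitSpace.mk Γ (α x) = OrbitSpace.mk Γ (β x)) : ∃ g ∈ Γ, α = g * β := by
  by_contra! hne
  have := countable_of_discrete Γ
  obtain ⟨x, hx⟩ := (dense_forall_notMem_affineSubspace
    (fun g : Γ => eqLocus α ((g : Isom E) * β))
    fun g h => hne g g.2 (eq_of_eqLocus_eq_top h)).nonempty
  obtain ⟨g, hg⟩ := OrbitSpace.mk_eq_mk.1 (h x)
  exact hx g hg.symm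

/-! ### Lifting isometries of the orbit space and continuing the lifts -/

theorem isClosed_liftLocus (f : OrbitSpace Γ ≃ᵢ OrbitSpace Γ) (α : Isom E) :
    IsClosed (liftLocus f α) := by
  have : liftLocus f α = {y | dist (f (OrbitSpace.mk Γ y)) (OrbitSpace.mk Γ (α y)) = 0} := by
    ext y
    exact ⟨fun h => by rw [Set.mem_ofPred_eq, mem_liftLocus.1 h, dist_self],
      fun h => OrbitSpace.eq_of_dist_eq_zero h⟩
  rw [this]
  have h1 := OrbitSpace.continuous_mk Γ
  exact isClosed_eq ((f.continuous.comp h1).dist (h1.comp α.continuous)) continuous_const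

theorem closure_interior_liftLocus_subset (f : OrbitSpace Γ ≃ᵢ OrbitSpace Γ) (α : Isom E) :
    closure (interior (liftLocus f α)) ⊆ liftLocus f α :=
  closure_minimal interior_subset (isClosed_liftLocus f α)

/-- Near a free point, an isometry of the orbit space lifts. -/
theorem exists_local_lift (f : OrbitSpace Γ ≃ᵢ OrbitSpace Γ) {x : E} (hx : IsFreePoint Γ x) :
    ∃ α : Isom E, x ∈ interior (liftLocus f α) := by
  obtain ⟨y, hy⟩ := OrbitSpace.mk_surjective Γ (f (OrbitSpace.mk Γ x))
  obtain ⟨r₁, hr₁, h₁⟩ := hx.exists_isometric_ball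
  obtain ⟨r₂, hr₂, h₂⟩ := (isFreePoint_of_map_eq f hy.symm hx).exists_isometric_ball
  choose σ hσ hσd using fun z => OrbitSpace.exists_rep y (f (OrbitSpace.mk Γ z))
  have hball : ∀ z ∈ Metric.ball x (min r₁ r₂), σ z ∈ Metric.ball y r₂ := fun z hz => by
    rw [Metric.mem_ball, hσd, hy, f.dist_eq]
    exact (OrbitSpace.dist_mk_le Γ z x).trans_lt (lt_of_lt_of_le hz (min_le_right _ _))
  have hmono := Metric.ball_subset_ball (x := x) (min_le_left r₁ r₂)
  obtain ⟨α, hα⟩ := exists_isom_eqOn_ball σ x (lt_min hr₁ hr₂) fun z hz w hw => by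
    rw [← h₂ _ (hball z hz) _ (hball w hw), hσ, hσ, f.dist_eq, h₁ _ (hmono hz) _ (hmono hw)]
  refine ⟨α, mem_interior.2 ⟨_, fun z hz => ?_, Metric.isOpen_ball,
    Metric.mem_ball_self (lt_min hr₁ hr₂)⟩⟩
  rw [mem_liftLocus, hα z hz, hσ]

/-- A lift extends across free points. -/
theorem mem_interior_liftLocus_of_isFreePoint {f : OrbitSpace Γ ≃ᵢ OrbitSpace Γ} {α : Isom E}
    {p : E} (hp : p ∈ closure (interior (liftLocus f α))) (hfree : IsFreePoint Γ p) :
    p ∈ interior (liftLocus f α) := by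
  have hpG : f (OrbitSpace.mk Γ p) = OrbitSpace.mk Γ (α p) :=
    closure_interior_liftLocus_subset f α hp
  obtain ⟨r₁, hr₁, h₁⟩ := hfree.exists_isometric_ball
  obtain ⟨r₂, hr₂, h₂⟩ := (isFreePoint_of_map_eq f hpG hfree).exists_isometric_ball
  have hr : 0 < min r₁ r₂ := lt_min hr₁ hr₂
  refine mem_interior.2 ⟨Metric.ball p (min r₁ r₂), fun y hy => ?_, Metric.isOpen_ball,
    Metric.mem_ball_self hr⟩
  have hmono := Metric.ball_subset_ball (x := p) (min_le_left r₁ r₂)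
  have hball : ∀ w ∈ Metric.ball p (min r₁ r₂), α w ∈ Metric.ball (α p) r₂ := fun w hw => by
    rw [Metric.mem_ball, α.dist_map]
    exact lt_of_lt_of_le hw (min_le_right _ _)
  obtain ⟨z, hz, hzd⟩ := OrbitSpace.exists_rep (α p) (f (OrbitSpace.mk Γ y))
  have hz2 : z ∈ Metric.ball (α p) r₂ := by
    rw [Metric.mem_ball, hzd, ← hpG, f.dist_eq]
    exact (OrbitSpace.dist_mk_le Γ y p).trans_lt (lt_of_lt_of_le hy (min_le_right _ _))
  have hW : (interior (liftLocus f α) ∩ Metric.ball p (min r₁ r₂)).Nonempty := by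
    rw [Set.inter_comm]
    exact mem_closure_iff.1 hp _ Metric.isOpen_ball (Metric.mem_ball_self hr)
  -- Both points have the same distances to the points near `p` where `α` is already known to be a
  -- lift, and these fill a nonempty open set.
  have heq : α⁻¹ z = y := by
    refine eq_of_dist_eq_on_isOpen (isOpen_interior.inter Metric.isOpen_ball) hW
      fun w ⟨hw1, hw2⟩ => ?_
    have hwG : f (OrbitSpace.mk Γ w) = OrbitSpace.mk Γ (α w) :=
      mem_liftLocus.1 (interior_subset hw1)
    rw [← α.dist_map, apply_inv_self, ← h₂ _ hz2 _ (hball w hw2), hz, ← hwG, f.dist_eq,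
      h₁ _ (hmono hy) _ (hmono hw2)]
  rw [mem_liftLocus, ← heq, apply_inv_self, hz, heq]

/-- If `α` lifts an isometry of the orbit space on a part of a mirror of `Γ`, then `α` maps the
mirror to a mirror of `Γ`. -/
theorem exists_conj_eq_reflection {f : OrbitSpace Γ ≃ᵢ OrbitSpace Γ} {α : Isom E} {p n : E}
    {ε : ℝ} (hε : 0 < ε) (hn : ‖n‖ = 1) {r : Isom E} (hrΓ : r ∈ Γ)
    (hr : ∀ y, r y = y - (2 * inner ℝ n (y - p)) • n)
    (hL : ∀ y ∈ Metric.ball p ε, inner ℝ n (y - p) = 0 → y ∈ liftLocus f α) :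
    ∃ g ∈ Γ, α * r = g * α := by
  have hr1 : r ≠ 1 := by
    rintro rfl
    have h1 := hr (p + n)
    rw [add_sub_cancel_left, real_inner_self_eq_norm_sq, hn] at h1
    have h2 : n = 0 := by simpa using eq_sub_iff_add_eq.1 h1
    simp [h2] at hn
  have := countable_of_discrete Γ
  let W : Submodule ℝ E := (Submodule.span ℝ {n})ᗮ
  have hW : ∀ v, v ∈ W ↔ inner ℝ n v = 0 := fun v =>
    Submodule.mem_orthogonal_singleton_iff_inner_right
  let j : W →ᵃ[ℝ] E := W.subtype.toAffineMap + AffineMap.const ℝ W p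
  have hj : ∀ v : W, j v = v + p := fun v => rfl
  -- Mirror points are not free, so neither are their images under `α`. Baire's theorem inside the
  -- hyperplane yields a single nontrivial `g` fixing the whole image; then `α⁻¹ * g * α` is
  -- nontrivial and fixes the mirror, so it is `r`.
  obtain ⟨g, hg1, hg⟩ : ∃ g : Γ, g ≠ 1 ∧ (eqLocus ((g : Isom E) * α) α).comap j = ⊤ := by
    by_contra! hne
    obtain ⟨v, hv, hvball⟩ := (dense_forall_notMem_affineSubspace
      (fun g : {g : Γ // g ≠ 1} => (eqLocus ((g.1 : Isom E) * α) α).comap j)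
      fun g => hne g.1 g.2).exists_mem_open (Metric.isOpen_ball (x := (0 : W)) (ε := ε))
        ⟨0, Metric.mem_ball_self hε⟩
    have hv0 : inner ℝ n (v + p - p : E) = 0 := by
      rw [add_sub_cancel_right]; exact (hW v).1 v.2
    have hvG : (v + p : E) ∈ liftLocus f α := hL _ (by simpa using hvball) hv0
    have hnf : ¬ IsFreePoint Γ (α (v + p)) := by
      rw [← isFreePoint_iff_of_map_eq f hvG]
      exact fun h => hr1 (h r hrΓ (by rw [hr, hv0]; simp))
    simp only [IsFreePoint, not_forall] at hnf
    obtain ⟨g, hgΓ, hgx, hg1⟩ := hnf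
    exact hv ⟨⟨g, hgΓ⟩, fun h => hg1 (congrArg Subtype.val h)⟩ hgx
  have hfix : ∀ v, inner ℝ n v = 0 → (α⁻¹ * g * α) (v + p) = v + p := fun v hv => by
    have h1 : (⟨v, (hW v).2 hv⟩ : W) ∈ (eqLocus ((g : Isom E) * α) α).comap j := by
      rw [hg]; trivial
    have h2 : (g : Isom E) (α (v + p)) = α (v + p) := h1
    rw [mul_apply, mul_apply, h2, inv_apply_self]
  have hp := hfix 0 (inner_zero_right _)
  rw [zero_add] at hp
  refine ⟨g, g.2, ?_⟩
  rcases eq_one_or_reflection hn hp (fun v hv => by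
    have h1 := apply_sub (α⁻¹ * (g : Isom E) * α) (v + p) p
    rw [hfix v hv, hp, add_sub_cancel_right] at h1
    exact h1.symm) with h | h
  · exfalso
    refine hg1 (Subtype.ext ?_)
    have h1 : (g : Isom E) = α * (α⁻¹ * g * α) * α⁻¹ := by group
    rw [h1, h, mul_one, mul_inv_cancel]; rfl
  · have h1 : r = α⁻¹ * g * α := AffineIsometryEquiv.ext fun y => by rw [hr, h]
    rw [h1]; group

/-- A lift extends across mirrors. -/
theorem mem_interior_liftLocus_of_reflection {f : OrbitSpace Γ ≃ᵢ OrbitSpace Γ} {α : Isom E}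
    {p n : E} (hp : p ∈ closure (interior (liftLocus f α))) (hn : ‖n‖ = 1)
    {r : Isom E} (hrΓ : r ∈ Γ) (hr : ∀ y, r y = y - (2 * inner ℝ n (y - p)) • n)
    (hstab : ∀ g ∈ Γ, g p = p → g = 1 ∨ g = r) : p ∈ interior (liftLocus f α) := by
  have hnn : inner ℝ n n = (1 : ℝ) := by rw [real_inner_self_eq_norm_sq, hn, one_pow]
  obtain ⟨δ, hδ, hgap⟩ := exists_orbit_gap Γ p
  set B := Metric.ball p (δ / 2) with hB
  have hpB : p ∈ B := Metric.mem_ball_self (by positivity)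
  have hrp : r p = p := by rw [hr]; simp
  have hrB : ∀ y ∈ B, r y ∈ B := fun y hy => by
    rw [hB, Metric.mem_ball]
    calc dist (r y) p = dist (r y) (r p) := by rw [hrp]
      _ = dist y p := r.dist_map y p
      _ < _ := hy
  have hrn : ∀ y, inner ℝ n (r y - p) = - inner ℝ n (y - p) := fun y => by
    rw [hr, sub_right_comm, inner_sub_right, inner_smul_right, hnn]; ring
  have hrr : ∀ y, r (r y) = y := fun y => by
    rw [hr (r y), hrn, hr y]; module
  -- An element fixing a point within `δ / 2` of `p` moves `p` by less than `δ`, hence fixes `p`.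
  have hfree : ∀ y ∈ B, inner ℝ n (y - p) ≠ 0 → IsFreePoint Γ y := fun y hy hyn g hg hgy => by
    have hgp : g p = p := by
      by_contra h
      have h1 := hgap g hg h
      have h2 : dist (g p) y = dist y p := by
        conv_lhs => rw [← hgy, g.dist_map, dist_comm]
      have h3 := dist_triangle (g p) y p
      have h4 : dist y p < δ / 2 := hy
      linarith
    rcases hstab g hg hgp with h | rfl
    · exact h
    · exfalso
      have h1 := hrn y
      rw [hgy] at h1
      exact hyn (by linarith)
  -- It suffices to treat the case that `α` is a lift on a part of the positive half-ball.
  have key : ∀ n' : E, ‖n'‖ = 1 → (∀ y, r y = y - (2 * inner ℝ n' (y - p)) • n') →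
      (∀ y, inner ℝ n' (r y - p) = - inner ℝ n' (y - p)) →
      (∀ y ∈ B, inner ℝ n' (y - p) ≠ 0 → IsFreePoint Γ y) →
      (∃ y ∈ B, y ∈ interior (liftLocus f α) ∧ 0 < inner ℝ n' (y - p)) →
      p ∈ interior (liftLocus f α) := by
    rintro n hn hr hrn hfree ⟨y₀, hy₀B, hy₀, hy₀n⟩
    have hnn : inner ℝ n n = (1 : ℝ) := by rw [real_inner_self_eq_norm_sq, hn, one_pow]
    let H : Set E := B ∩ {y | 0 < inner ℝ n (y - p)}
    -- The open half-ball is connected and consists of free points, so the lift spreads over it, and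
    -- by closedness to the mirror.
    have hH : H ⊆ interior (liftLocus f α) := by
      have hconv : Convex ℝ H := by
        refine (convex_ball p (δ / 2)).inter ?_
        have : {y | 0 < inner ℝ n (y - p)} = {y | inner ℝ n p < innerSL ℝ n y} := by
          ext y
          change 0 < inner ℝ n (y - p) ↔ inner ℝ n p < inner ℝ n y
          rw [inner_sub_right, sub_pos]
        rw [this]
        exact convex_halfSpace_gt (innerSL ℝ n).isLinear _
      refine hconv.isPreconnected.subset_of_closure_inter_subset isOpen_interior
        ⟨y₀, ⟨hy₀B, hy₀n⟩, hy₀⟩ ?_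
      rintro y ⟨hy, hyB, hyn⟩
      exact mem_interior_liftLocus_of_isFreePoint hy (hfree y hyB hyn.ne')
    have hL : ∀ y ∈ B, inner ℝ n (y - p) = 0 → y ∈ liftLocus f α := by
      intro y hy hyn
      refine closure_interior_liftLocus_subset f α (closure_mono hH ?_)
      have hlim : Filter.Tendsto (fun t : ℝ => y + t • n) (𝓝[>] 0) (𝓝 y) := by
        have : Filter.Tendsto (fun t : ℝ => y + t • n) (𝓝 0) (𝓝 (y + (0 : ℝ) • n)) :=
          Continuous.tendsto (by fun_prop) 0
        rw [zero_smul, add_zero] at this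
        exact this.mono_left nhdsWithin_le_nhds
      refine mem_closure_of_tendsto hlim ?_
      filter_upwards [hlim (Metric.isOpen_ball.mem_nhds hy), self_mem_nhdsWithin] with t ht ht0
      refine ⟨ht, ?_⟩
      rw [Set.mem_ofPred_eq, add_sub_right_comm, inner_add_right, hyn, inner_smul_right, hnn]
      simpa using ht0
    obtain ⟨g, hg, hgα⟩ := exists_conj_eq_reflection (by positivity) hn hrΓ hr hL
    refine mem_interior.2 ⟨B, fun y hy => ?_, Metric.isOpen_ball, hpB⟩
    -- The other half-ball is reached by reflection: `f` agrees at the orbits of `y` and `r y`, and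
    -- `α (r y) = g (α y)` lies in the orbit of `α y`.
    rcases lt_trichotomy (inner ℝ n (y - p)) 0 with h | h | h
    · have h1 : r y ∈ liftLocus f α :=
        interior_subset (hH ⟨hrB y hy, by rw [Set.mem_ofPred_eq, hrn]; linarith⟩)
      rw [mem_liftLocus, OrbitSpace.mk_smul hrΓ] at h1
      rw [mem_liftLocus, h1, ← OrbitSpace.mk_smul hg (α y)]
      exact congrArg _ (congrArg (fun k : Isom E => k y) hgα)
    · exact hL y hy h
    · exact interior_subset (hH ⟨hy, h⟩)
  -- A free point is off the mirror; the sign of the normal is chosen to put it in the positive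
  -- half.
  obtain ⟨y, hyfree, hyB, hy⟩ := (dense_isFreePoint Γ).exists_mem_open
    (Metric.isOpen_ball.inter isOpen_interior)
    (mem_closure_iff.1 hp B Metric.isOpen_ball hpB)
  have hyn : inner ℝ n (y - p) ≠ 0 := fun h => by
    have h1 : r = 1 := hyfree r hrΓ (by rw [hr, h]; simp)
    have h2 := hrn (p + n)
    rw [h1] at h2
    simp only [AffineIsometryEquiv.coe_one, id, add_sub_cancel_left, hnn] at h2
    norm_num at h2
  rcases lt_or_gt_of_ne hyn with h | h
  · refine key (-n) (by rwa [norm_neg]) (fun y => ?_) (fun y => ?_) (fun y hy hyn => ?_)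
      ⟨y, hyB, hy, by rw [inner_neg_left]; linarith⟩
    · rw [hr, inner_neg_left]; module
    · rw [inner_neg_left, inner_neg_left, hrn]
    · exact hfree y hy (by rwa [inner_neg_left, neg_ne_zero] at hyn)
  · exact key n hn hr hrn hfree ⟨y, hyB, hy, h⟩

/-- If two isometries fix `p`, and their common fixed points span the space together with one
further point, then they fix a common hyperplane through `p`. -/
theorem exists_common_normal {g h : Isom E} {x p : E} (hgp : g p = p) (hhp : h p = p)
    (hg1 : g ≠ 1)
    (htop : affineSpan ℝ (insert x (eqLocus g 1 ⊓ eqLocus h 1 : AffineSubspace ℝ E) : Set E) = ⊤) :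
    ∃ n : E, ‖n‖ = 1 ∧ ∀ v, inner ℝ n v = 0 → lin g v = v ∧ lin h v = v := by
  let D : Submodule ℝ E := LinearMap.ker ((lin g - 1 : E →L[ℝ] E) : E →ₗ[ℝ] E) ⊓
    LinearMap.ker ((lin h - 1 : E →L[ℝ] E) : E →ₗ[ℝ] E)
  have hD : ∀ v, v ∈ D ↔ lin g v = v ∧ lin h v = v := fun v => by
    rw [Submodule.mem_inf, LinearMap.mem_ker, LinearMap.mem_ker]
    exact and_congr sub_eq_zero sub_eq_zero
  have hle : affineSpan ℝ (insert x (eqLocus g 1 ⊓ eqLocus h 1 : AffineSubspace ℝ E) : Set E) ≤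
      AffineSubspace.mk' p (D ⊔ Submodule.span ℝ {x - p}) := by
    refine affineSpan_le.2 (Set.insert_subset ?_ ?_)
    · rw [SetLike.mem_coe, AffineSubspace.mem_mk']
      exact Submodule.mem_sup_right (Submodule.mem_span_singleton_self _)
    · rintro y ⟨hy1, hy2⟩
      rw [SetLike.mem_coe, AffineSubspace.mem_mk']
      refine Submodule.mem_sup_left ((hD _).2 ⟨?_, ?_⟩)
      · have h1 : g y = y := hy1
        change lin g (y - p) = y - p
        rw [← apply_sub, h1, hgp]
      · have h1 : h y = y := hy2
        change lin h (y - p) = y - p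
        rw [← apply_sub, h1, hhp]
  rw [htop, top_le_iff] at hle
  have hdir := congrArg AffineSubspace.direction hle
  rw [AffineSubspace.direction_mk', AffineSubspace.direction_top] at hdir
  have hDtop : D ≠ ⊤ := fun hDtop => hg1 <| AffineIsometryEquiv.ext fun y => by
    have h1 := ((hD (y - p)).1 (hDtop ▸ Submodule.mem_top)).1
    rw [← apply_sub, hgp] at h1
    exact sub_left_injective h1
  obtain ⟨n, hn, hnD⟩ := exists_unit_normal hDtop hdir
  exact ⟨n, hn, fun v hv => (hD v).1 (hnD v hv)⟩

/-- A local lift of an isometry of the orbit space is a global lift. -/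
theorem liftLocus_eq_univ {f : OrbitSpace Γ ≃ᵢ OrbitSpace Γ} {α : Isom E} {x : E}
    (hfree : IsFreePoint Γ x) (hx : x ∈ interior (liftLocus f α)) : liftLocus f α = Set.univ := by
  have := countable_of_discrete Γ
  -- Endpoints `x'` outside all proper `A k` are dense, so by closedness it suffices to lift at
  -- these. Pairs are needed to compare two stabilizer elements; `(g, 1)` handles one.
  let A : Γ × Γ → AffineSubspace ℝ E := fun k => affineSpan ℝ
    (insert x (eqLocus (k.1 : Isom E) 1 ⊓ eqLocus (k.2 : Isom E) 1 : AffineSubspace ℝ E) : Set E)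
  have hdense := dense_forall_notMem_affineSubspace
    (fun k : {k : Γ × Γ // A k ≠ ⊤} => A k.1) fun k => k.2
  refine Set.eq_univ_of_univ_subset ?_
  rw [← hdense.closure_eq]
  refine closure_minimal (fun x' hx' => ?_) (isClosed_liftLocus f α)
  refine interior_subset ((convex_segment x x').isPreconnected.subset_of_closure_inter_subset
    isOpen_interior ⟨x, left_mem_segment ℝ x x', hx⟩ ?_ (right_mem_segment ℝ x x'))
  rintro p ⟨hp, hpseg⟩
  by_cases hpfree : IsFreePoint Γ p
  · exact mem_interior_liftLocus_of_isFreePoint hp hpfree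
  -- `A (g, h)` contains `x` and `p`, hence the line through them and its point `x'`; genericity of
  -- `x'` forces it to be everything. So any two elements of the stabilizer of `p` fix a common
  -- hyperplane.
  have htop : ∀ g h : Γ, (g : Isom E) p = p → (h : Isom E) p = p → A (g, h) = ⊤ := by
    intro g h hg hh
    by_contra hne
    refine hx' ⟨(g, h), hne⟩ ?_
    have hxA : x ∈ A (g, h) := subset_affineSpan _ _ (Set.mem_insert _ _)
    have hpA : p ∈ A (g, h) := subset_affineSpan _ _ (Set.mem_insert_of_mem _ ⟨hg, hh⟩)
    rw [segment_eq_image_lineMap] at hpseg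
    obtain ⟨t, -, rfl⟩ := hpseg
    have ht : t ≠ 0 := by
      rintro rfl
      rw [AffineMap.lineMap_apply_zero] at hpfree
      exact hpfree hfree
    have h1 : x' = AffineMap.lineMap x (AffineMap.lineMap x x' t) t⁻¹ := by
      rw [AffineMap.lineMap_lineMap_right, mul_comm, mul_inv_cancel₀ ht,
        AffineMap.lineMap_apply_one]
    rw [h1]
    exact AffineMap.lineMap_mem _ hxA hpA
  simp only [IsFreePoint, not_forall] at hpfree
  obtain ⟨r, hrΓ, hrp, hr1⟩ := hpfree
  obtain ⟨n, hn, hnr⟩ := exists_common_normal hrp rfl hr1 (htop ⟨r, hrΓ⟩ 1 hrp rfl)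
  have hr := (eq_one_or_reflection hn hrp fun v hv => (hnr v hv).1).resolve_left hr1
  refine mem_interior_liftLocus_of_reflection hp hn hrΓ hr fun g hg hgp => ?_
  obtain ⟨n', hn', hn'r⟩ := exists_common_normal hrp hgp hr1 (htop ⟨r, hrΓ⟩ ⟨g, hg⟩ hrp hgp)
  have hr' := (eq_one_or_reflection hn' hrp fun v hv => (hn'r v hv).1).resolve_left hr1
  refine (eq_one_or_reflection hn' hgp fun v hv => (hn'r v hv).2).imp_right fun h => ?_
  exact AffineIsometryEquiv.ext fun y => by rw [h, hr']

/-- Every isometry of the orbit space of a discrete group lifts to an isometry of the space. -/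
theorem exists_lift (f : OrbitSpace Γ ≃ᵢ OrbitSpace Γ) :
    ∃ α : Isom E, ∀ x, f (OrbitSpace.mk Γ x) = OrbitSpace.mk Γ (α x) := by
  obtain ⟨x, hx⟩ := (dense_isFreePoint Γ).nonempty
  obtain ⟨α, hα⟩ := exists_local_lift f hx
  exact ⟨α, fun y => (liftLocus_eq_univ hx hα).ge (Set.mem_univ y)⟩

/-- A lift `α` of `f` normalizes `Γ`: the conjugate of `g ∈ Γ` by `α` induces the identity on the
orbit space, hence lies in `Γ`, and likewise for the converse. -/
theorem starHom_surjective : Function.Surjective (starHom Γ) := by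
  intro f
  obtain ⟨α, hα⟩ := exists_lift f
  have hmem : α ∈ isomNormalizer Γ := by
    refine Subgroup.mem_normalizer_iff.2 fun g => ⟨fun hg => ?_, fun hg => ?_⟩
    · obtain ⟨k, hk, h⟩ := exists_eq_mul_of_mk_eq (Γ := Γ) (α := α * g * α⁻¹) (β := 1) fun x => by
        rw [mul_apply, mul_apply, ← hα, OrbitSpace.mk_smul hg, hα, apply_inv_self]; rfl
      rw [h, mul_one]
      exact hk
    · obtain ⟨k, hk, h⟩ := exists_eq_mul_of_mk_eq (Γ := Γ) (α := g) (β := 1) fun x => by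
        refine f.injective ?_
        rw [hα, hα]
        have h1 := OrbitSpace.mk_smul hg (α x)
        rw [mul_apply, mul_apply, inv_apply_self] at h1
        exact h1
      rw [h, mul_one]
      exact hk
  refine ⟨⟨α, hmem⟩, IsometryEquiv.ext fun p => ?_⟩
  obtain ⟨x, rfl⟩ := OrbitSpace.mk_surjective Γ p
  rw [starHom_mk, hα]

theorem exists_eq_mul_of_starHom_eq {a b : isomNormalizer Γ} (h : starHom Γ a = starHom Γ b) :
    ∃ g ∈ Γ, (a : Isom E) = g * b :=
  exists_eq_mul_of_mk_eq fun x => by rw [← starHom_mk, ← starHom_mk, h]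

end Lifting

/-! ### The fibre product of the normalizer of `M` and `Δ` -/

section FiberedGroup

theorem EProd.ext {V W : Type*} {x y : EProd V W} (h1 : x.fst = y.fst) (h2 : x.snd = y.snd) :
    x = y :=
  (WithLp.equiv 2 (V × W)).injective (Prod.ext h1 h2)

variable {V W : Type*} [NormedAddCommGroup V] [InnerProductSpace ℝ V]
  [NormedAddCommGroup W] [InnerProductSpace ℝ W]

open Isom

theorem spanOf_extend {M : Subgroup (Isom V)} (hM : spanOf M = ⊤) :
    spanOf (extend W M) = firstFactor V W := by
  refine le_antisymm (Submodule.span_le.2 ?_) ?_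
  · rintro a ⟨μ, -, h⟩
    have h1 := congrArg (fun g : Isom (EProd V W) => (g 0).snd) h
    change (0 : W) = (a + 0).snd at h1
    rw [add_zero] at h1
    exact h1.symm
  · have key : ∀ v ∈ spanOf M, EProd.pair v (0 : W) ∈ spanOf (extend W M) := by
      intro v hv
      unfold spanOf at hv
      induction hv using Submodule.span_induction with
      | mem a ha =>
        refine Submodule.subset_span ?_
        have : AffineIsometryEquiv.constVAdd ℝ (EProd V W) (EProd.pair a 0) =
            prodHom V W (AffineIsometryEquiv.constVAdd ℝ V a, 1) :=
          AffineIsometryEquiv.ext fun x => EProd.ext rfl (zero_add x.snd)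
        rw [Set.mem_ofPred_eq, this]
        exact mem_extend.2 ⟨ha, rfl⟩
      | zero => exact Submodule.zero_mem _
      | add y z _ _ hy hz =>
        have : EProd.pair (y + z) (0 : W) = EProd.pair y 0 + EProd.pair z 0 :=
          EProd.ext rfl (add_zero (0 : W)).symm
        rw [this]
        exact Submodule.add_mem _ hy hz
      | smul c y _ hy =>
        have : EProd.pair (c • y) (0 : W) = c • EProd.pair y 0 :=
          EProd.ext rfl (smul_zero c).symm
        rw [this]
        exact Submodule.smul_mem _ c hy
    intro x hx
    have : x = EProd.pair x.fst 0 := EProd.ext rfl hx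
    rw [this]
    exact key _ (hM ▸ Submodule.mem_top)

/-- The group of the isometries `(v, w) ↦ (α v, δ w)` with `δ ∈ Δ` and `α_⋆ = Θ(δ)`. -/
noncomputable def fiberedGroup (M : Subgroup (Isom V)) (Δ : Subgroup (Isom W))
    (Θ : Δ →* (OrbitSpace M ≃ᵢ OrbitSpace M)) : Subgroup (Isom (EProd V W)) :=
  (MonoidHom.eqLocus ((starHom M).comp (MonoidHom.fst (isomNormalizer M) Δ))
    (Θ.comp (MonoidHom.snd (isomNormalizer M) Δ))).map
    ((prodHom V W).comp ((isomNormalizer M).subtype.prodMap Δ.subtype))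

variable {M : Subgroup (Isom V)} {Δ : Subgroup (Isom W)}
  {Θ : Δ →* (OrbitSpace M ≃ᵢ OrbitSpace M)}

theorem mem_fiberedGroup {g : Isom (EProd V W)} : g ∈ fiberedGroup M Δ Θ ↔
    ∃ (a : isomNormalizer M) (δ : Δ), starHom M a = Θ δ ∧
      prodHom V W ((a : Isom V), (δ : Isom W)) = g :=
  ⟨fun ⟨p, hp, h⟩ => ⟨p.1, p.2, hp, h⟩, fun ⟨a, δ, h1, h2⟩ => ⟨(a, δ), h1, h2⟩⟩

theorem extend_le_fiberedGroup : extend W M ≤ fiberedGroup M Δ Θ := by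
  rintro _ ⟨μ, hμ, rfl⟩
  refine mem_fiberedGroup.2 ⟨⟨μ, Subgroup.le_normalizer hμ⟩, 1, ?_, rfl⟩
  rw [map_one]
  refine IsometryEquiv.ext fun p => ?_
  obtain ⟨x, rfl⟩ := OrbitSpace.mk_surjective M p
  rw [starHom_mk, OrbitSpace.mk_smul hμ]; rfl

theorem lin_prodHom_pair (α : Isom V) (β : Isom W) (v : V) (w : W) :
    lin (prodHom V W (α, β)) (EProd.pair v w) = EProd.pair (lin α v) (lin β w) := by
  rw [lin_apply, lin_apply, lin_apply]
  exact EProd.ext rfl rfl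

variable [FiniteDimensional ℝ V]

theorem mem_extend_of_starHom_eq_one [DiscreteTopology M] {a : isomNormalizer M}
    (h : starHom M a = 1) : prodHom V W ((a : Isom V), 1) ∈ extend W M := by
  obtain ⟨g, hg, h⟩ := exists_eq_mul_of_starHom_eq (b := 1) (h.trans (map_one _).symm)
  refine mem_extend.2 ⟨?_, rfl⟩
  rw [h, OneMemClass.coe_one, mul_one]
  exact hg

/-- First bring the second coordinate near `0` by some `δ`, lift `Θ(δ)` to act on the first, then
correct the first coordinate by `M`, which leaves the second alone. -/
theorem exists_norm_le_fiberedGroup [DiscreteTopology M] {d e : ℝ}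
    (hd : ∀ v : V, ∃ g ∈ M, ‖g v‖ ≤ d) (he : ∀ w : W, ∃ g ∈ Δ, ‖g w‖ ≤ e) (x : EProd V W) :
    ∃ g ∈ fiberedGroup M Δ Θ, ‖g x‖ ≤ d + e := by
  obtain ⟨δ, hδ, hδe⟩ := he x.snd
  obtain ⟨a, ha⟩ := starHom_surjective (Θ ⟨δ, hδ⟩)
  obtain ⟨μ, hμ, hμd⟩ := hd ((a : Isom V) x.fst)
  refine ⟨prodHom V W (μ, 1) * prodHom V W ((a : Isom V), δ), Subgroup.mul_mem _
    (extend_le_fiberedGroup (mem_extend.2 ⟨hμ, rfl⟩))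
    (mem_fiberedGroup.2 ⟨a, ⟨δ, hδ⟩, ha, rfl⟩), ?_⟩
  have h1 : (prodHom V W (μ, 1) * prodHom V W ((a : Isom V), δ)) x =
      EProd.pair (μ ((a : Isom V) x.fst)) 0 + EProd.pair 0 (δ x.snd) :=
    EProd.ext (add_zero _).symm (zero_add _).symm
  rw [h1]
  refine (norm_add_le _ _).trans (add_le_add ?_ ?_)
  · rw [WithLp.norm_toLp_fst]; exact hμd
  · rw [WithLp.norm_toLp_snd]; exact hδe

theorem isCompleteNormal_fiberedGroup [DiscreteTopology M] (hM : spanOf M = ⊤) :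
    IsCompleteNormal (extend W M) (fiberedGroup M Δ Θ) where
  le := extend_le_fiberedGroup
  normal := by
    refine ⟨fun g hg k => ?_⟩
    obtain ⟨a, δ, -, hk⟩ := mem_fiberedGroup.1 k.2
    obtain ⟨μ, hμ, hg⟩ := Subgroup.mem_subgroupOf.1 hg
    refine Subgroup.mem_subgroupOf.2 ?_
    have : ((k * g * k⁻¹ : fiberedGroup M Δ Θ) : Isom (EProd V W)) =
        prodHom V W ((a : Isom V) * μ * (a : Isom V)⁻¹, 1) := by
      rw [Subgroup.coe_mul, Subgroup.coe_mul, Subgroup.coe_inv, ← hk, ← hg]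
      change prodHom V W _ * prodHom V W (μ, 1) * (prodHom V W _)⁻¹ = _
      rw [← map_inv, ← map_mul, ← map_mul]
      simp
    rw [this]
    exact mem_extend.2 ⟨isomNormalizer.conj_mem a ⟨μ, hμ⟩, rfl⟩
  mem_iff := by
    intro g hg
    rw [spanOf_extend hM]
    constructor
    · rintro ⟨μ, -, rfl⟩
      refine ⟨rfl, fun w hw => ?_⟩
      rw [mem_firstFactor_orthogonal] at hw
      have h1 : w = EProd.pair 0 w.snd := EProd.ext hw rfl
      change lin (prodHom V W (μ, 1)) w = w
      rw [h1, lin_prodHom_pair, map_zero, lin_one]; rfl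
    · rintro ⟨h0, hfix⟩
      obtain ⟨a, δ, hΘ, rfl⟩ := mem_fiberedGroup.1 hg
      -- A translation part in `V` gives `δ 0 = 0`, and fixing `Vᗮ` gives `δ` trivial linear part.
      -- Then `a_⋆ = 1`, which puts `a` in `M`.
      have hδ : δ = 1 := by
        refine Subtype.ext (ext_lin ?_ h0)
        refine ContinuousLinearMap.ext fun w => ?_
        have h1 := hfix (EProd.pair 0 w) (mem_firstFactor_orthogonal.2 rfl)
        change lin (prodHom V W ((a : Isom V), (δ : Isom W))) _ = _ at h1
        rw [lin_prodHom_pair] at h1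
        rw [OneMemClass.coe_one, lin_one]
        exact congrArg WithLp.snd h1
      subst hδ
      rw [map_one] at hΘ
      exact mem_extend_of_starHom_eq_one hΘ

variable [FiniteDimensional ℝ W]

theorem discrete_fiberedGroup [DiscreteTopology M] [DiscreteTopology Δ] :
    DiscreteTopology (fiberedGroup M Δ Θ) := by
  refine discrete_of_finite _ fun R => ?_
  choose b hb using fun δ : Δ => starHom_surjective (Θ δ)
  have hfinΔ : {δ : Δ | ‖(δ : Isom W) 0‖ ≤ R}.Finite :=
    Set.Finite.of_finite_image ((finite_of_discrete Δ R).subset (by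
      rintro _ ⟨δ, hδ, rfl⟩
      exact ⟨δ.2, hδ⟩)) Subtype.val_injective.injOn
  -- Bounded displacement leaves finitely many `δ`. Over each, the first components form the coset
  -- `M * b δ`, of which discreteness of `M` leaves finitely many.
  refine (hfinΔ.biUnion fun δ _ => (finite_of_discrete_dist M ((b δ : Isom V) 0) 0 R).image
    fun μ => prodHom V W (μ * b δ, (δ : Isom W))).subset ?_
  rintro g ⟨hg, hgR⟩
  obtain ⟨a, δ, hΘ, rfl⟩ := mem_fiberedGroup.1 hg
  obtain ⟨μ, hμ, h⟩ := exists_eq_mul_of_starHom_eq (hΘ.trans (hb δ).symm)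
  have h1 : ‖(a : Isom V) 0‖ ≤ R := (WithLp.norm_fst_le (p := 2) _ _).trans hgR
  have h2 : ‖(δ : Isom W) 0‖ ≤ R := (WithLp.norm_snd_le (p := 2) _ _).trans hgR
  refine Set.mem_biUnion (x := δ) h2 ⟨μ, ⟨hμ, ?_⟩, by rw [h]⟩
  rw [dist_zero_right, ← mul_apply, ← h]
  exact h1

theorem isSpaceGroup_fiberedGroup {m k : ℕ} (hM : IsSpaceGroup m M) (hΔ : IsSpaceGroup k Δ) :
    IsSpaceGroup (m + k) (fiberedGroup M Δ Θ) := by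
  have := hM.discrete
  have := hM.compact
  have := hΔ.discrete
  have := hΔ.compact
  obtain ⟨d, hd⟩ := exists_norm_le_of_compact M
  obtain ⟨e, he⟩ := exists_norm_le_of_compact Δ
  refine ⟨?_, discrete_fiberedGroup,
    compact_of_exists_norm_le _ (d + e) (exists_norm_le_fiberedGroup hd he)⟩
  rw [(WithLp.linearEquiv 2 ℝ (V × W)).finrank_eq, Module.finrank_prod, hM.finrank_eq,
    hΔ.finrank_eq]

theorem primeGroup_fiberedGroup [DiscreteTopology M] (hV : spanOf (extend W M) = firstFactor V W)
    (hN : IsCompleteNormal (extend W M) (fiberedGroup M Δ Θ)) : primeGroup hV hN = Δ := by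
  ext β
  constructor
  · rintro ⟨γ, rfl⟩
    obtain ⟨a, δ, -, h⟩ := mem_fiberedGroup.1 γ.2
    rw [(components_unique hV hN γ _ _ h.symm).2]
    exact δ.2
  · intro hβ
    obtain ⟨a, ha⟩ := starHom_surjective (Θ ⟨β, hβ⟩)
    exact ⟨⟨_, mem_fiberedGroup.2 ⟨a, ⟨β, hβ⟩, ha, rfl⟩⟩, (components_unique hV hN _ _ _ rfl).2⟩

theorem Xi_fiberedGroup (hV : spanOf (extend W M) = firstFactor V W)
    (hN : IsCompleteNormal (extend W M) (fiberedGroup M Δ Θ)) (hP : primeGroup hV hN = Δ)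
    (x : fiberedGroup M Δ Θ ⧸ (extend W M).subgroupOf (fiberedGroup M Δ Θ)) :
    Xi hV hN x = Θ (MulEquiv.subgroupCongr hP (PIso hV hN x)) := by
  obtain ⟨γ, rfl⟩ := QuotientGroup.mk_surjective x
  obtain ⟨a, δ, hΘ, h⟩ := mem_fiberedGroup.1 γ.2
  obtain ⟨h1, h2⟩ := components_unique hV hN γ _ _ h.symm
  have h3 : MulEquiv.subgroupCongr hP (PIso hV hN (QuotientGroup.mk γ)) = δ := Subtype.ext h2
  rw [h3, ← hΘ]
  refine IsometryEquiv.ext fun p => ?_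
  obtain ⟨v, rfl⟩ := OrbitSpace.mk_surjective M p
  rw [Xi_mk, h1, starHom_mk]

theorem eq_fiberedGroup [DiscreteTopology M] (hV : spanOf (extend W M) = firstFactor V W)
    {Γ : Subgroup (Isom (EProd V W))} (hN : IsCompleteNormal (extend W M) Γ)
    (hP : primeGroup hV hN = Δ)
    (hΞ : ∀ x : Γ ⧸ (extend W M).subgroupOf Γ,
      Xi hV hN x = Θ (MulEquiv.subgroupCongr hP (PIso hV hN x))) :
    Γ = fiberedGroup M Δ Θ := by
  have hmem : ∀ γ : Γ, primeHom hV hN γ ∈ Δ := fun γ => hP ▸ ⟨γ, rfl⟩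
  have hstar : ∀ γ : Γ, starHom M ⟨_, barHom_mem_normalizer hV hN γ⟩ = Θ ⟨_, hmem γ⟩ :=
    fun γ => hΞ (QuotientGroup.mk γ)
  ext g
  constructor
  · intro hg
    exact mem_fiberedGroup.2 ⟨_, _, hstar ⟨g, hg⟩, prodHom_components hV hN ⟨g, hg⟩⟩
  · intro hg
    obtain ⟨a, δ, hΘ, rfl⟩ := mem_fiberedGroup.1 hg
    obtain ⟨γ, hγ⟩ : (δ : Isom W) ∈ primeGroup hV hN := hP ▸ δ.2
    have h1 : (⟨_, hmem γ⟩ : Δ) = δ := Subtype.ext hγ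
    -- `a` and `γ̄` both induce `Θ δ`, so they differ by some `μ ∈ M`, and `N ≤ Γ` absorbs it.
    obtain ⟨μ, hμ, h⟩ := exists_eq_mul_of_starHom_eq
      (hΘ.trans ((congrArg Θ h1).symm.trans (hstar γ).symm))
    have h2 : prodHom V W ((a : Isom V), (δ : Isom W)) =
        prodHom V W (μ, 1) * (γ : Isom (EProd V W)) := by
      rw [← prodHom_components hV hN γ, ← map_mul, Prod.mk_mul_mk, one_mul, hγ, h]
    rw [h2]
    exact Γ.mul_mem (hN.le (mem_extend.2 ⟨hμ, rfl⟩)) γ.2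

end FiberedGroup

theorem theorem18 (n m : ℕ) (hmn : m ≤ n)
    (M : Subgroup (Isom (Euc m))) (hM : IsSpaceGroup m M)
    (Δ : Subgroup (Isom (Euc (n - m)))) (hΔ : IsSpaceGroup (n - m) Δ)
    (Θ : Δ →* (OrbitSpace M ≃ᵢ OrbitSpace M)) :
    ∃ hV : spanOf (extend (Euc (n - m)) M) = firstFactor (Euc m) (Euc (n - m)),
      ∃! Γ : Subgroup (Isom (EProd (Euc m) (Euc (n - m)))),
        IsSpaceGroup n Γ ∧
        ∃ hN : IsCompleteNormal (extend (Euc (n - m)) M) Γ,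
        ∃ hP : primeGroup hV hN = Δ,
          ∀ x : Γ ⧸ (extend (Euc (n - m)) M).subgroupOf Γ,
            Xi hV hN x = Θ (MulEquiv.subgroupCongr hP (PIso hV hN x)) := by
  have := hM.discrete
  have hspan := hM.spanOf_eq_top
  have hV := spanOf_extend (W := Euc (n - m)) hspan
  have hN := isCompleteNormal_fiberedGroup (Θ := Θ) hspan
  have hP := primeGroup_fiberedGroup hV hN
  have hgroup := isSpaceGroup_fiberedGroup (Θ := Θ) hM hΔ
  rw [Nat.add_sub_cancel' hmn] at hgroup
  refine ⟨hV, fiberedGroup M Δ Θ, ⟨hgroup, hN, hP, Xi_fiberedGroup hV hN hP⟩, ?_⟩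
  rintro Γ ⟨-, hN', hP', hΞ⟩
  exact eq_fiberedGroup hV hN' hP' hΞ
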